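/- Let $\mathbb D$ be the open unit disc and $dA=\frac{dx\,dy}{\pi}$ the normalized area measure on $\mathbb D$. Let $\widehat{\mathcal D}$ be the class of radial weights $\omega$ (that is, $\omega:\mathbb D\to[0,\infty)$ is integrable with respect to $dA$ and $\omega(z)=\omega(|z|)$) for which there is a constant $K<\infty$ such that $\widehat\omega(r)=\int_r^1\omega(s)\,ds$ satisfies $\widehat\omega(r)\le K\,\widehat\omega\left(\frac{1+r}{2}\right)$ for all $0\le r<1$. For $E\subset\mathbb D$ write $\omega(E)=\int_E\omega\,dA$. For $\zeta\in\mathbb D\setminus\{0\}$ let $$\Gamma(\zeta)=\left\{z\in\mathbb D\setminus\{0\}:\ |\arg\zeta-\arg z|<\tfrac12\left(1-\tfrac{|z|}{|\zeta|}\right)\right\}$$ (the difference of the arguments being reduced modulo $2\pi$ to $(-\pi,\pi]$), and let $T(z)=\{\zeta\in\mathbb D\setminus\{0\}:z\in\Gamma(\zeta)\}$. Let $\nu$ be a positive Borel measure on $\mathbb D$ that is finite on compact subsets of $\mathbb D$. For $0<q<\infty$ and a $\nu$-measurable function $f:\mathbb D\to\mathbb C$ put $$A_{q,\nu}(f)(\zeta)=\left(\int_{\Gamma(\zeta)}|f|^q\,d\nu\right)^{1/q},\qquad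 A_{\infty,\nu}(f)(\zeta)=\nu\text{-}\operatorname*{ess\,sup}_{z\in\Gamma(\zeta)}|f(z)|,$$ $$C_{q,\nu}(f)(\zeta)=\left(\sup_{a\in\Gamma(\zeta)}\frac{1}{\omega(T(a))}\int_{T(a)}|f(z)|^q\,\omega(T(z))\,d\nu(z)\right)^{1/q}$$ (with $\frac10\cdot0=0$, which is needed only if $\omega=0$ almost everywhere). For $0<p<\infty$ and $0<q\le\infty$ the tent space $T^p_q(\nu,\omega)$ consists of the $\nu$-equivalence classes of $\nu$-measurable $f$ with $\|f\|_{T^p_q(\nu,\omega)}=\left(\int_{\mathbb D}A_{q,\nu}(f)^p\,\omega\,dA\right)^{1/p}<\infty$; for $0<q<\infty$ the tent space $T^\infty_q(\nu,\omega)$ consists of those with $\|f\|_{T^\infty_q(\nu,\omega)}=\|C_{q,\nu}(f)\|_{L^\infty(\mathbb D)}<\infty$. **Theorem.** Let $0<p,q<\infty$ and $\omega\in\widehat{\mathcal D}$. There is a constant $0<C<\infty$, depending only on $p$, $q$ and $\omega$, such that the following holds for every positive Borel measure $\nu$ on $\mathbb D$ that is finite on compact sets. 1. If $g\in T^p_\infty(\nu,\omega)$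 and $h\in T^\infty_q(\nu,\omega)$, then $gh\in T^p_q(\nu,\omega)$ and $\|gh\|_{T^p_q(\nu,\omega)}\le C\,\|g\|_{T^p_\infty(\nu,\omega)}\,\|h\|_{T^\infty_q(\nu,\omega)}$. 2. Conversely, every $f\in T^p_q(\nu,\omega)$ can be written as $f=gh$ with $g\in T^p_\infty(\nu,\omega)$ and $h\in T^\infty_q(\nu,\omega)$ such that $C^{-1}\|f\|_{T^p_q(\nu,\omega)}\le\|g\|_{T^p_\infty(\nu,\omega)}\le C\,\|f\|_{T^p_q(\nu,\omega)}$ and $\|h\|_{T^\infty_q(\nu,\omega)}\le C$. -/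

import Mathlib

open MeasureTheory Set
open scoped ENNReal NNReal

noncomputable section

namespace WeightedTent

/-- The open unit disc of the complex plane. -/
def disc : Set ℂ := Metric.ball (0 : ℂ) 1

/-- Normalized Lebesgue area measure `dA = dx dy / π` on the unit disc. -/
def area : Measure ℂ := (ENNReal.ofReal Real.pi)⁻¹ • (volume.restrict disc)

/-- The measure `ω dA` on the unit disc; its value at a set `E` is `ω(E)`. -/
def weightMeasure (ω : ℂ → ℝ≥0) : Measure ℂ := area.withDensity (fun z => (ω z : ℝ≥0∞))

/-- `\hat ω(r) = ∫_r^1 ω(s) ds`. -/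
def tail (ω : ℂ → ℝ≥0) (r : ℝ) : ℝ≥0∞ := ∫⁻ s in Ioo r 1, (ω (s : ℂ) : ℝ≥0∞)

/-- The class of radial weights (nonnegative integrable functions `ω` on the disc with
`ω(z) = ω(|z|)`) such that `\hat ω(r) ≤ C \hat ω((1 + r) / 2)` for all `0 ≤ r < 1`, for some finite
constant `C`. Values of `ω` outside the disc are irrelevant. -/
structure IsDoublingWeight (ω : ℂ → ℝ≥0) : Prop where
  aemeasurable : AEMeasurable ω (volume.restrict disc)
  integrable : ∫⁻ z in disc, (ω z : ℝ≥0∞) < ∞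
  radial : ∀ z ∈ disc, ω z = ω (‖z‖ : ℂ)
  doubling : ∃ C : ℝ≥0, ∀ r : ℝ, 0 ≤ r → r < 1 → tail ω r ≤ C * tail ω ((1 + r) / 2)

/-- Positive Borel measures on the unit disc that are finite on compact subsets of the disc. They
are represented as measures on the plane that are carried by the disc. -/
structure IsDiscMeasure (ν : Measure ℂ) : Prop where
  compl_disc : ν discᶜ = 0
  finite_compact : ∀ K : Set ℂ, K ⊆ disc → IsCompact K → ν K < ∞

/-- The lens `Γ(ζ) = {z : |arg ζ - arg z| < (1 - |z| / |ζ|) / 2}` for `ζ ≠ 0`. The difference of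
the arguments is read modulo `2π`, as the principal argument of `z / ζ`; a point `z` of the lens has
an argument, so `z ≠ 0`. A point of the lens has `|z| < |ζ|`, hence `Γ(ζ)` lies in the disc if
`ζ` does. -/
def lens (ζ : ℂ) : Set ℂ :=
  {z | ζ ≠ 0 ∧ z ≠ 0 ∧ |Complex.arg (z / ζ)| < (1 / 2) * (1 - ‖z‖ / ‖ζ‖)}

/-- The tent `T(z) = {ζ ∈ 𝔻 : z ∈ Γ(ζ)}`. -/
def tent (z : ℂ) : Set ℂ := {ζ | ζ ∈ disc ∧ z ∈ lens ζ}

/-- `A_{q,ν}(f)(ζ) = (∫_{Γ(ζ)} |f|^q dν)^{1/q}`, for `0 < q < ∞`. -/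
def areaFn (q : ℝ) (ν : Measure ℂ) (f : ℂ → ℂ) (ζ : ℂ) : ℝ≥0∞ :=
  (∫⁻ z in lens ζ, ‖f z‖ₑ ^ q ∂ν) ^ (1 / q)

/-- `A_{∞,ν}(f)(ζ)`, the `ν`-essential supremum of `|f|` over `Γ(ζ)`. -/
def maxFn (ν : Measure ℂ) (f : ℂ → ℂ) (ζ : ℂ) : ℝ≥0∞ :=
  essSup (fun z => ‖f z‖ₑ) (ν.restrict (lens ζ))

/-- `C_{q,ν}(f)(ζ) = (sup_{a ∈ Γ(ζ)} ω(T(a))⁻¹ ∫_{T(a)} |f(z)|^q ω(T(z)) dν(z))^{1/q}`. -/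
def carlesonFn (q : ℝ) (ν : Measure ℂ) (ω : ℂ → ℝ≥0) (f : ℂ → ℂ) (ζ : ℂ) : ℝ≥0∞ :=
  (⨆ a ∈ lens ζ,
    (∫⁻ z in tent a, ‖f z‖ₑ ^ q * weightMeasure ω (tent z) ∂ν) / weightMeasure ω (tent a))
      ^ (1 / q)

/-- The `L^p_ω` quasi-norm of a nonnegative function. -/
def lpNorm (p : ℝ) (ω : ℂ → ℝ≥0) (F : ℂ → ℝ≥0∞) : ℝ≥0∞ :=
  (∫⁻ ζ, F ζ ^ p ∂(weightMeasure ω)) ^ (1 / p)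

/-- The quasi-norm of `T^p_q(ν, ω)`, for `0 < p, q < ∞`. -/
def normPQ (p q : ℝ) (ν : Measure ℂ) (ω : ℂ → ℝ≥0) (f : ℂ → ℂ) : ℝ≥0∞ :=
  lpNorm p ω (areaFn q ν f)

/-- The quasi-norm of `T^p_∞(ν, ω)`, for `0 < p < ∞`. -/
def normPInf (p : ℝ) (ν : Measure ℂ) (ω : ℂ → ℝ≥0) (f : ℂ → ℂ) : ℝ≥0∞ :=
  lpNorm p ω (maxFn ν f)

/-- The quasi-norm of `T^∞_q(ν, ω)`, for `0 < q < ∞`: the `L^∞` norm of `C_{q,ν}(f)` over the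
disc. -/
def normInfQ (q : ℝ) (ν : Measure ℂ) (ω : ℂ → ℝ≥0) (f : ℂ → ℂ) : ℝ≥0∞ :=
  essSup (carlesonFn q ν ω f) area

/-- The tent space `T^p_q(ν, ω)` of `ν`-equivalence classes of `ν`-measurable functions. -/
def TentPQ (p q : ℝ) (ν : Measure ℂ) (ω : ℂ → ℝ≥0) : Set (ℂ →ₘ[ν] ℂ) :=
  {f | normPQ p q ν ω f < ∞}

/-- The tent space `T^p_∞(ν, ω)`. -/
def TentPInf (p : ℝ) (ν : Measure ℂ) (ω : ℂ → ℝ≥0) : Set (ℂ →ₘ[ν] ℂ) :=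
  {f | normPInf p ν ω f < ∞}

/-- The tent space `T^∞_q(ν, ω)`. -/
def TentInfQ (q : ℝ) (ν : Measure ℂ) (ω : ℂ → ℝ≥0) : Set (ℂ →ₘ[ν] ℂ) :=
  {f | normInfQ q ν ω f < ∞}

end WeightedTent

end

namespace WeightedTent

/-! ### Lenses and tents in terms of angles -/

open InnerProductGeometry

/-! Put μ = ω dA. After the polar-coordinate estimates, the weight enters only through
`TentDoubling`: tents have positive μ-mass, and the box about a tent, as well as any tent at most
four times its size, has mass at most a constant times that of the tent. If ω vanishes almost
everywhere, every norm is zero and the theorem is trivial.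

Product. Boundedness of `C_q(h)` says that |h|^q μ(T(z)) dν is a Carleson measure, so it integrates
any X ≥ 0 to at most a constant times the μ-integral of the lens-wise essential supremum of X
(`lintegral_le_of_tent_le`). With A(ζ) the integral of |g|^q |h|^q over Γ(ζ) and an exponent t > 1,
A is tested against φ = A^(t-1). Fubini turns the pairing into an integral of |g|^q times the tent
averages of φ against the Carleson measure; the embedding, Hölder and the maximal theorem for tent
averages finish. An arbitrary exponent p/q reduces to p/q + 1 by pulling a fractional power of |g|^q
out of the lens integral.

Factorization. Let A = A_q(f)^q, let G(z) be the harmonic mean of A over T(z), and set |g|^q = G, h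
= f/g. If G(z) > t, then A > t/2 on at least half of T(z), so a Vitali covering bounds the lens
supremum of G by A in L^s for every s > 0; no maximal theorem is needed, hence no restriction on p.
Moreover |h|^q μ(T(z)) = |f|^q times the integral of 1/A over T(z). When this is integrated over
T(a) dν, Fubini pairs 1/A with a part of the integral defining A, so the integrand is at most 1 and
lives in the box about a: this is the Carleson condition for h. The lower bound for the norm of g
follows from the product estimate. -/

theorem mem_disc {z : ℂ} : z ∈ disc ↔ ‖z‖ < 1 := by
  simp [disc]

/-- The unoriented angle has a triangle inequality and no branch cut, which is all that the tent
geometry needs from the argument. -/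
theorem mem_lens {ζ z : ℂ} :
    z ∈ lens ζ ↔ ζ ≠ 0 ∧ z ≠ 0 ∧ angle z ζ < 1 / 2 * (1 - ‖z‖ / ‖ζ‖) := by
  constructor
  · rintro ⟨h1, h2, h3⟩
    exact ⟨h1, h2, by rwa [Complex.angle_eq_abs_arg h2 h1]⟩
  · rintro ⟨h1, h2, h3⟩
    exact ⟨h1, h2, by rwa [← Complex.angle_eq_abs_arg h2 h1]⟩

theorem mem_tent {ζ z : ℂ} :
    ζ ∈ tent z ↔ ‖ζ‖ < 1 ∧ ζ ≠ 0 ∧ z ≠ 0 ∧ angle z ζ < 1 / 2 * (1 - ‖z‖ / ‖ζ‖) := by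
  rw [← mem_lens, ← mem_disc]; rfl

theorem norm_lt_of_mem_lens {ζ z : ℂ} (h : z ∈ lens ζ) : ‖z‖ < ‖ζ‖ := by
  obtain ⟨h1, h2, h3⟩ := mem_lens.1 h
  have h4 := angle_nonneg z ζ
  have h5 : 0 < ‖ζ‖ := norm_pos_iff.2 h1
  have h6 : ‖z‖ / ‖ζ‖ < 1 := by linarith
  rwa [div_lt_one h5] at h6

theorem tent_subset_disc (z : ℂ) : tent z ⊆ disc := fun _ h => h.1

theorem mem_disc_of_mem_tent {ζ z : ℂ} (h : ζ ∈ tent z) : z ∈ disc := by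
  have := norm_lt_of_mem_lens h.2
  exact mem_disc.2 (this.trans (mem_disc.1 h.1))

theorem ne_zero_of_mem_tent {ζ z : ℂ} (h : ζ ∈ tent z) : z ≠ 0 := h.2.2.1

theorem tent_zero : tent 0 = ∅ := by
  ext ζ; simp [mem_tent]

theorem tent_eq_empty_of_notMem {z : ℂ} (h : z ∉ disc) : tent z = ∅ := by
  ext ζ
  simp only [mem_empty_iff_false, iff_false]
  exact fun hζ => h (mem_disc_of_mem_tent hζ)

theorem isOpen_lens_rel : IsOpen {x : ℂ × ℂ | x.2 ∈ lens x.1} := by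
  rw [isOpen_iff_mem_nhds]
  rintro ⟨ζ, z⟩ h
  obtain ⟨h1, h2, h3⟩ := mem_lens.1 h
  have c1 : ContinuousAt (fun x : ℂ × ℂ => angle x.2 x.1) (ζ, z) :=
    ContinuousAt.comp (f := fun x : ℂ × ℂ => (x.2, x.1)) (g := fun y : ℂ × ℂ => angle y.1 y.2)
      (continuousAt_angle (x := (z, ζ)) h2 h1) (by fun_prop)
  have c2 : ContinuousAt (fun x : ℂ × ℂ => 1 / 2 * (1 - ‖x.2‖ / ‖x.1‖)) (ζ, z) := by
    have : ‖ζ‖ ≠ 0 := norm_ne_zero_iff.2 h1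
    fun_prop (disch := assumption)
  have e1 : ∀ᶠ x : ℂ × ℂ in nhds (ζ, z), x.1 ≠ 0 :=
    (continuous_fst.continuousAt (x := (ζ, z))).eventually_ne h1
  have e2 : ∀ᶠ x : ℂ × ℂ in nhds (ζ, z), x.2 ≠ 0 :=
    (continuous_snd.continuousAt (x := (ζ, z))).eventually_ne h2
  filter_upwards [c1.eventually_lt c2 h3, e1, e2] with x hx hx1 hx2
  exact mem_lens.2 ⟨hx1, hx2, hx⟩

theorem isOpen_tent_rel : IsOpen {x : ℂ × ℂ | x.1 ∈ tent x.2} := by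
  have : {x : ℂ × ℂ | x.1 ∈ tent x.2} = Prod.fst ⁻¹' disc ∩ {x : ℂ × ℂ | x.2 ∈ lens x.1} := rfl
  rw [this]
  exact (Metric.isOpen_ball.preimage continuous_fst).inter isOpen_lens_rel

theorem isOpen_lens (ζ : ℂ) : IsOpen (lens ζ) :=
  isOpen_lens_rel.preimage (f := fun z => (ζ, z)) (by fun_prop)

theorem isOpen_tent (z : ℂ) : IsOpen (tent z) :=
  isOpen_tent_rel.preimage (f := fun ζ => (ζ, z)) (by fun_prop)

theorem tent_nonempty {a : ℂ} (ha : a ∈ disc) (h0 : a ≠ 0) : (tent a).Nonempty := by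
  have h1 : 0 < ‖a‖ := norm_pos_iff.2 h0
  have h2 := mem_disc.1 ha
  have hc : 0 < (1 + ‖a‖) / (2 * ‖a‖) := by positivity
  have hn : ‖(((1 + ‖a‖) / (2 * ‖a‖) : ℝ) • a)‖ = (1 + ‖a‖) / 2 := by
    rw [norm_smul, Real.norm_of_nonneg hc.le]; field_simp
  refine ⟨((1 + ‖a‖) / (2 * ‖a‖) : ℝ) • a, mem_tent.2 ⟨by rw [hn]; linarith, ?_, h0, ?_⟩⟩
  · exact smul_ne_zero hc.ne' h0
  · rw [hn, angle_smul_right_of_pos _ _ hc, angle_self h0]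
    have : ‖a‖ / ((1 + ‖a‖) / 2) < 1 := by rw [div_lt_one (by positivity)]; linarith
    linarith

/-! ### Boxes and coverings by tents -/

/-- A Carleson box about `b`, of size comparable to `1 - |b|`, that contains every tent meeting
`T(b)` whose size is at most twice that of `T(b)`. -/
def box (b : ℂ) : Set ℂ :=
  {η | ‖η‖ < 1 ∧ η ≠ 0 ∧ 1 - 3 * (1 - ‖b‖) < ‖η‖ ∧ angle b η < 5 / 2 * (1 - ‖b‖)}

theorem box_ne_zero {b η : ℂ} (h : η ∈ box b) : η ≠ 0 := h.2.1

theorem angle_lt_of_mem_tent {ζ a : ℂ} (h : ζ ∈ tent a) : angle a ζ < 1 / 2 * (1 - ‖a‖) := by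
  obtain ⟨h1, h2, h3, h4⟩ := mem_tent.1 h
  have h5 : 0 < ‖ζ‖ := norm_pos_iff.2 h2
  have h6 : ‖a‖ ≤ ‖a‖ / ‖ζ‖ := by
    rw [le_div_iff₀ h5]; nlinarith [norm_nonneg a]
  linarith

theorem norm_lt_of_mem_tent {ζ a : ℂ} (h : ζ ∈ tent a) : ‖a‖ < ‖ζ‖ := norm_lt_of_mem_lens h.2

/-- In units of 1 - |b|, the path from b to a point common to both tents, to a, to a point of T(a)
costs angles 1/2, 1 and 1, whence 5/2. The apex a is not in its own tent; it is included because
measures on the side of ν charge apices. -/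
theorem tent_subset_box {a b : ℂ} (h : (tent a ∩ tent b).Nonempty)
    (hab : 1 - ‖a‖ ≤ 2 * (1 - ‖b‖)) : insert a (tent a) ⊆ box b := by
  obtain ⟨ζ, hζa, hζb⟩ := h
  have h1 := angle_lt_of_mem_tent hζa
  have h2 := angle_lt_of_mem_tent hζb
  have h2' : angle b a < 3 / 2 * (1 - ‖b‖) := by
    have h3 := angle_le_angle_add_angle b ζ a
    rw [angle_comm ζ a] at h3
    linarith
  have ha := mem_disc.1 (mem_disc_of_mem_tent hζa)
  have hb := mem_disc.1 (mem_disc_of_mem_tent hζb)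
  rintro η (rfl | hη)
  · exact ⟨ha, ne_zero_of_mem_tent hζa, by linarith, by linarith⟩
  · have h4 := angle_lt_of_mem_tent hη
    have h5 := norm_lt_of_mem_tent hη
    have h6 := angle_le_angle_add_angle b a η
    exact ⟨(mem_tent.1 hη).1, (mem_tent.1 hη).2.1, by linarith, by linarith⟩

theorem tent_subset_box_of_mem {a z : ℂ} (h : z ∈ tent a) : tent z ⊆ box a := by
  intro ζ hζ
  have h1 := angle_lt_of_mem_tent h
  have h2 := angle_lt_of_mem_tent hζ
  have h3 := norm_lt_of_mem_tent h
  have h4 := norm_lt_of_mem_tent hζ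
  have h5 := angle_le_angle_add_angle a z ζ
  have h6 := (mem_tent.1 hζ).1
  exact ⟨h6, (mem_tent.1 hζ).2.1, by linarith, by linarith⟩

/-- Vitali selection with 1 - |a| as the size and enlargement factor 2. Countability comes from the
disjoint tents being open and nonempty. -/
theorem exists_disjoint_tents (S : Set ℂ) (hS : ∀ a ∈ S, a ∈ disc ∧ a ≠ 0) :
    ∃ u ⊆ S, u.Countable ∧ u.PairwiseDisjoint tent ∧
      (⋃ a ∈ S, insert a (tent a)) ⊆ ⋃ b ∈ u, box b := by
  obtain ⟨u, hu, hd, hc⟩ := Vitali.exists_disjoint_subfamily_covering_enlargement tent S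
    (fun a => 1 - ‖a‖) 2 (by norm_num) (fun a ha => by
      have := mem_disc.1 (hS a ha).1; linarith) 1
    (fun a _ => by have := norm_nonneg a; linarith)
    (fun a ha => tent_nonempty (hS a ha).1 (hS a ha).2)
  refine ⟨u, hu, ?_, hd, ?_⟩
  · exact hd.countable_of_isOpen (fun a _ => isOpen_tent a)
      (fun a ha => tent_nonempty (hS a (hu ha)).1 (hS a (hu ha)).2)
  · refine iUnion₂_subset fun a ha => ?_
    obtain ⟨b, hb, h1, h2⟩ := hc a ha
    exact (tent_subset_box h1 h2).trans (subset_biUnion_of_mem (u := box) hb)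

/-- Finitely many tents of size comparable to `1 - |b|` cover the box about `b` away from the
origin. -/
theorem box_subset_iUnion_tent {b : ℂ} (hb : b ∈ disc) (h0 : b ≠ 0) {ε : ℝ} (hε : 0 < ε)
    (hε' : ε < 1) :
    ∃ a : ℤ → ℂ, (∀ j, a j ∈ disc ∧ a j ≠ 0 ∧ 1 - ‖a j‖ ≤ 4 * (1 - ‖b‖)) ∧
      box b ∩ {η | 2 * ε ≤ ‖η‖} ⊆ ⋃ j ∈ Finset.Icc (-10 : ℤ) 10, tent (a j) := by
  set δ := 1 - ‖b‖ with hδ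
  have hb1 := mem_disc.1 hb
  have hb0 : 0 < ‖b‖ := norm_pos_iff.2 h0
  have hδ0 : 0 < δ := by linarith
  have hδ1 : δ < 1 := by linarith
  -- All apices have modulus ρ. The value 1 - 4δ lies below the inner radius 1 - 3δ of the box, and
  -- ε keeps the apices off the origin. For |η| ≥ 2ε in the box this gives ρ/|η| < 1 - δ/4, so the
  -- tents have half-width more than δ/8 there, and arguments spaced by δ/4 suffice.
  set ρ := max ε (1 - 4 * δ) with hρ
  have hρ0 : 0 < ρ := lt_max_of_lt_left hε
  have hρ1 : ρ < 1 := max_lt hε' (by linarith)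
  let a : ℤ → ℂ := fun j =>
    ((ρ / ‖b‖ : ℝ) : ℂ) * (b * Complex.exp (((j * (δ / 4) : ℝ) : ℂ) * Complex.I))
  have hna : ∀ j, ‖a j‖ = ρ := fun j => by
    simp only [a, norm_mul, Complex.norm_exp_ofReal_mul_I, Complex.norm_real, Real.norm_eq_abs]
    rw [abs_of_pos (by positivity)]; field_simp
  have ha0 : ∀ j, a j ≠ 0 := fun j => by
    rw [← norm_pos_iff, hna]; exact hρ0
  refine ⟨a, fun j => ⟨mem_disc.2 (by rw [hna]; exact hρ1), ha0 j, ?_⟩, ?_⟩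
  · rw [hna]
    have := le_max_right ε (1 - 4 * δ)
    linarith
  rintro η ⟨⟨hη1, hη0, hη2, hη3⟩, hη4⟩
  change 2 * ε ≤ ‖η‖ at hη4
  have hη5 : 0 < ‖η‖ := norm_pos_iff.2 hη0
  rw [angle_comm, Complex.angle_eq_abs_arg hη0 h0] at hη3
  set t := (η / b).arg with ht
  set j := round (4 * t / δ) with hj
  have hr := abs_sub_round (4 * t / δ)
  rw [← hj] at hr
  have h4 : |t - j * (δ / 4)| ≤ δ / 8 := by
    have e : t - j * (δ / 4) = (4 * t / δ - j) * (δ / 4) := by field_simp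
    rw [e, abs_mul, abs_of_pos (by positivity : 0 < δ / 4)]
    nlinarith
  have hjb : |(j : ℝ)| < 11 := by
    have h6 : |4 * t / δ| < 10 := by
      rw [abs_div, abs_mul, abs_of_pos hδ0, div_lt_iff₀ hδ0]
      norm_num; linarith
    rw [abs_lt] at h6 ⊢
    rw [abs_le] at hr
    constructor <;> linarith
  have hjm : j ∈ Finset.Icc (-10 : ℤ) 10 := by
    rw [abs_lt] at hjb
    obtain ⟨h7, h8⟩ := hjb
    have h7' : (-11 : ℤ) < j := by exact_mod_cast h7
    have h8' : j < (11 : ℤ) := by exact_mod_cast h8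
    rw [Finset.mem_Icc]; omega
  refine mem_iUnion₂.2 ⟨j, hjm, mem_tent.2 ⟨hη1, hη0, ha0 j, ?_⟩⟩
  have key : η / a j = ((‖η‖ / ρ : ℝ) : ℂ) *
      Complex.exp (((t - j * (δ / 4) : ℝ) : ℂ) * Complex.I) := by
    rw [div_eq_iff (ha0 j)]
    have e1 : η / b = ((‖η / b‖ : ℝ) : ℂ) * Complex.exp ((t : ℂ) * Complex.I) :=
      (Complex.norm_mul_exp_arg_mul_I _).symm
    have e2 : η = ((‖η / b‖ : ℝ) : ℂ) * Complex.exp ((t : ℂ) * Complex.I) * b := by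
      rw [← e1]; field_simp
    have hbC : ((‖b‖ : ℝ) : ℂ) ≠ 0 := by exact_mod_cast hb0.ne'
    have hρC : (ρ : ℂ) ≠ 0 := by exact_mod_cast hρ0.ne'
    have e3 : Complex.exp ((t : ℂ) * Complex.I) =
        Complex.exp (((t - j * (δ / 4) : ℝ) : ℂ) * Complex.I) *
          Complex.exp (((j * (δ / 4) : ℝ) : ℂ) * Complex.I) := by
      rw [← Complex.exp_add]; congr 1; push_cast; ring
    conv_lhs => rw [e2, norm_div, e3]
    simp only [a]
    rw [Complex.ofReal_div, Complex.ofReal_div, Complex.ofReal_div]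
    field_simp
  rw [angle_comm, Complex.angle_eq_abs_arg hη0 (ha0 j), key, Complex.arg_real_mul _ (by positivity),
    Complex.arg_exp_mul_I, (toIocMod_eq_self _).2, hna]
  · refine h4.trans_lt ?_
    have : ρ / ‖η‖ < 1 - δ / 4 := by
      rw [div_lt_iff₀ hη5, hρ, max_lt_iff]
      constructor <;> nlinarith
    linarith
  · rw [abs_le] at h4
    have := Real.pi_gt_three
    constructor <;> linarith

/-! ### Radial weights in polar coordinates -/

theorem measurableSet_disc : MeasurableSet disc := measurableSet_ball

/-- The Jacobian is positive on the polar domain, so null sets pull back to null sets. -/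
theorem ae_polarCoord_symm_notMem {N : Set ℂ} (hN : volume N = 0) :
    ∀ᵐ p ∂((volume.restrict (Ioi (0 : ℝ))).prod (volume.restrict (Ioo (-Real.pi) Real.pi))),
      Complex.polarCoord.symm p ∉ N := by
  have hM := measurableSet_toMeasurable volume N
  have h1 := Complex.lintegral_comp_polarCoord_symm ((toMeasurable volume N).indicator 1)
  rw [lintegral_indicator_one hM, measure_toMeasurable, hN] at h1
  have hmeas : Measurable (fun p : ℝ × ℝ => Complex.polarCoord.symm p) := by
    simp only [Complex.polarCoord_symm_apply]; fun_prop
  rw [lintegral_eq_zero_iff] at h1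
  · rw [Measure.prod_restrict]
    have ht : MeasurableSet polarCoord.target := polarCoord.open_target.measurableSet
    have h2 := h1.and (ae_restrict_mem ht)
    rw [polarCoord_target] at h2
    filter_upwards [h2] with p hp hpN
    have h3 := hp.1
    have h4 : 0 < p.1 := hp.2.1
    simp only [smul_eq_mul, Pi.zero_apply, mul_eq_zero, ENNReal.ofReal_eq_zero] at h3
    rcases h3 with h3 | h3
    · linarith
    · rw [indicator_of_mem (subset_toMeasurable _ _ hpN)] at h3
      simp at h3
  · exact (ENNReal.measurable_ofReal.comp measurable_fst).mul
      ((measurable_one.indicator hM).comp hmeas)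

theorem norm_polarCoord_symm' {p : ℝ × ℝ} (hp : 0 < p.1) : ‖Complex.polarCoord.symm p‖ = p.1 := by
  rw [Complex.norm_polarCoord_symm, abs_of_pos hp]

theorem angle_one_polarCoord_symm {p : ℝ × ℝ} (hp : p ∈ Ioi (0 : ℝ) ×ˢ Ioo (-Real.pi) Real.pi) :
    angle 1 (Complex.polarCoord.symm p) = |p.2| := by
  have h0 : 0 < p.1 := hp.1
  have h1 : Complex.polarCoord.symm p ≠ 0 := by
    rw [← norm_pos_iff, norm_polarCoord_symm' h0]; exact h0
  rw [angle_comm, Complex.angle_eq_abs_arg h1 one_ne_zero, div_one, Complex.polarCoord_symm_apply,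
    Complex.ofReal_cos, Complex.ofReal_sin,
    Complex.arg_mul_cos_add_sin_mul_I h0 ⟨hp.2.1, hp.2.2.le⟩]

theorem volume_Ioo_inter_abs_lt (w : ℝ) :
    volume (Ioo (-Real.pi) Real.pi ∩ {θ : ℝ | |θ| < w}) = ENNReal.ofReal (2 * min w Real.pi) := by
  have : Ioo (-Real.pi) Real.pi ∩ {θ : ℝ | |θ| < w} = Ioo (-min w Real.pi) (min w Real.pi) := by
    ext θ
    change (-Real.pi < θ ∧ θ < Real.pi) ∧ |θ| < w ↔ -min w Real.pi < θ ∧ θ < min w Real.pi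
    rw [← abs_lt, ← abs_lt, lt_min_iff, and_comm]
  rw [this, Real.volume_Ioo]; congr 1; ring

/-- The angular sector about the direction of `b` whose half-width at distance `s` from the origin
is `w s`. -/
def sector (b : ℂ) (w : ℝ → ℝ) : Set ℂ := {η | η ≠ 0 ∧ angle b η < w ‖η‖}

theorem measurable_angle (b : ℂ) : Measurable (fun η : ℂ => angle b η) := by
  unfold angle; fun_prop

theorem measurableSet_sector (b : ℂ) {w : ℝ → ℝ} (hw : Measurable w) :
    MeasurableSet (sector b w) :=
  (measurableSet_singleton (0 : ℂ)).compl.inter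
    (measurableSet_lt (measurable_angle b) (hw.comp measurable_norm))

theorem lintegral_sector_one {w : ℝ → ℝ} (hw : Measurable w) {f : ℝ → ℝ≥0∞} (hf : Measurable f) :
    ∫⁻ z in sector 1 w, f ‖z‖ =
      ∫⁻ s in Ioi (0 : ℝ), ENNReal.ofReal s * f s * ENNReal.ofReal (2 * min (w s) Real.pi) := by
  rw [← lintegral_indicator (measurableSet_sector 1 hw), ← Complex.lintegral_comp_polarCoord_symm]
  have hE : MeasurableSet {p : ℝ × ℝ | |p.2| < w p.1} :=
    measurableSet_lt (measurable_snd.abs) (hw.comp measurable_fst)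
  have ht : MeasurableSet polarCoord.target := polarCoord.open_target.measurableSet
  have e1 : ∫⁻ p in polarCoord.target, ENNReal.ofReal p.1 •
        (sector 1 w).indicator (fun z => f ‖z‖) (Complex.polarCoord.symm p) =
      ∫⁻ p in polarCoord.target,
        {p : ℝ × ℝ | |p.2| < w p.1}.indicator (fun p => ENNReal.ofReal p.1 * f p.1) p := by
    refine setLIntegral_congr_fun ht fun p hp => ?_
    rw [polarCoord_target] at hp
    have h0 : 0 < p.1 := hp.1
    have h1 : Complex.polarCoord.symm p ≠ 0 := by
      rw [← norm_pos_iff, norm_polarCoord_symm' h0]; exact h0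
    have h2 : Complex.polarCoord.symm p ∈ sector 1 w ↔ p ∈ {p : ℝ × ℝ | |p.2| < w p.1} := by
      change _ ≠ 0 ∧ angle 1 _ < w ‖Complex.polarCoord.symm p‖ ↔ _
      rw [angle_one_polarCoord_symm hp, norm_polarCoord_symm' h0]
      exact and_iff_right h1
    by_cases h : p ∈ {p : ℝ × ℝ | |p.2| < w p.1}
    · simp only [smul_eq_mul, indicator_of_mem (h2.2 h), indicator_of_mem h,
        norm_polarCoord_symm' h0]
    · simp only [smul_eq_mul, indicator_of_notMem (mt h2.1 h), indicator_of_notMem h, mul_zero]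
  have hm : Measurable (fun p : ℝ × ℝ => ENNReal.ofReal p.1 * f p.1) :=
    (ENNReal.measurable_ofReal.comp measurable_fst).mul (hf.comp measurable_fst)
  rw [e1, polarCoord_target, Measure.volume_eq_prod, ← Measure.prod_restrict,
    lintegral_prod _ (hm.indicator hE).aemeasurable]
  refine lintegral_congr fun s => ?_
  have hE' : MeasurableSet {θ : ℝ | |θ| < w s} :=
    measurableSet_lt measurable_id.abs measurable_const
  have e2 : ∀ θ : ℝ, {p : ℝ × ℝ | |p.2| < w p.1}.indicator
      (fun p => ENNReal.ofReal p.1 * f p.1) (s, θ) =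
      {θ : ℝ | |θ| < w s}.indicator (fun _ => ENNReal.ofReal s * f s) θ := fun θ => rfl
  simp_rw [e2]
  rw [lintegral_indicator hE', setLIntegral_const, Measure.restrict_apply hE', inter_comm,
    volume_Ioo_inter_abs_lt]

/-- A rotation carries the direction of b to that of 1, where the angle is the absolute value of the
polar angle. -/
theorem lintegral_sector {b : ℂ} (hb : b ≠ 0) {w : ℝ → ℝ} (hw : Measurable w) {f : ℝ → ℝ≥0∞}
    (hf : Measurable f) :
    ∫⁻ z in sector b w, f ‖z‖ =
      ∫⁻ s in Ioi (0 : ℝ), ENNReal.ofReal s * f s * ENNReal.ofReal (2 * min (w s) Real.pi) := by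
  rw [← lintegral_sector_one hw hf, ← lintegral_indicator (measurableSet_sector b hw),
    ← lintegral_indicator (measurableSet_sector 1 hw)]
  have hb0 : 0 < ‖b‖ := norm_pos_iff.2 hb
  let c : Circle := ⟨((‖b‖⁻¹ : ℝ) : ℂ) * b, by
    rw [Submonoid.unitSphere, ← SetLike.mem_coe]
    change _ ∈ Metric.sphere (0 : ℂ) 1
    rw [mem_sphere_zero_iff_norm, norm_mul, Complex.norm_real, norm_inv, norm_norm]
    field_simp⟩
  rw [← (LinearIsometryEquiv.measurePreserving (rotation c)).lintegral_comp_emb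
    (rotation c).toHomeomorph.measurableEmbedding]
  refine lintegral_congr fun z => ?_
  have e1 : b = ‖b‖ • rotation c 1 := by
    rw [rotation_apply, mul_one, Complex.real_smul]
    change b = (‖b‖ : ℂ) * (((‖b‖⁻¹ : ℝ) : ℂ) * b)
    have : (‖b‖ : ℂ) ≠ 0 := by exact_mod_cast hb0.ne'
    push_cast; field_simp
  have e2 : rotation c z ∈ sector b w ↔ z ∈ sector 1 w := by
    have : angle b (rotation c z) = angle 1 z := by
      rw [e1, angle_smul_left_of_pos _ _ hb0]
      exact LinearIsometry.angle_map (rotation c).toLinearIsometry 1 z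
    change rotation c z ≠ 0 ∧ angle b (rotation c z) < w ‖rotation c z‖ ↔ z ≠ 0 ∧ angle 1 z < w ‖z‖
    rw [this, LinearIsometryEquiv.norm_map, Ne, LinearIsometryEquiv.map_eq_zero_iff]
  by_cases h : z ∈ sector 1 w
  · rw [indicator_of_mem h, indicator_of_mem (e2.2 h), LinearIsometryEquiv.norm_map]
  · rw [indicator_of_notMem h, indicator_of_notMem (mt e2.1 h)]

/-- The restriction of a radial function to a radius, up to null sets. -/
theorem IsDoublingWeight.exists_profile {ω : ℂ → ℝ≥0} (hω : IsDoublingWeight ω) :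
    ∃ W : ℝ → ℝ≥0, Measurable W ∧ (∀ᵐ s : ℝ ∂(volume.restrict (Ioo (0 : ℝ) 1)), ω (s : ℂ) = W s) ∧
      ∀ᵐ z ∂(volume.restrict disc), ω z = W ‖z‖ := by
  have hd := measurableSet_disc
  obtain ⟨ω₀, hm, hae⟩ := hω.aemeasurable
  have hN : volume {z | ¬ (z ∈ disc → ω z = ω₀ z)} = 0 := (ae_restrict_iff' hd).1 hae
  have h1 := ae_polarCoord_symm_notMem hN
  have h2 := (Measure.measurePreserving_swap
    (μ := volume.restrict (Ioo (-Real.pi) Real.pi))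
    (ν := volume.restrict (Ioi (0 : ℝ)))).quasiMeasurePreserving.ae h1
  have h3 := Measure.ae_ae_of_ae_prod h2
  have hpi := Real.pi_pos
  have : (ae (volume.restrict (Ioo (-Real.pi) Real.pi))).NeBot := by
    rw [ae_neBot, Ne, Measure.restrict_eq_zero, Real.volume_Ioo, ENNReal.ofReal_eq_zero]
    linarith
  -- The positive real axis, on which `tail` is computed, is itself a null set. Fubini supplies some
  -- ray on which ω agrees almost everywhere with its measurable version, and radiality transports
  -- this to the axis.
  obtain ⟨θ, hθ⟩ := h3.exists
  have hW : Measurable (fun s : ℝ => ω₀ (Complex.polarCoord.symm (s, θ))) := by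
    refine hm.comp ?_
    simp only [Complex.polarCoord_symm_apply]; fun_prop
  have h4 : ∀ᵐ s : ℝ ∂(volume.restrict (Ioo (0 : ℝ) 1)),
      ω (s : ℂ) = ω₀ (Complex.polarCoord.symm (s, θ)) := by
    have h5 := ae_restrict_of_ae_restrict_of_subset (Ioo_subset_Ioi_self (a := (1 : ℝ)) (b := 0)) hθ
    filter_upwards [h5, ae_restrict_mem measurableSet_Ioo] with s hs hs1
    have hn : ‖Complex.polarCoord.symm (s, θ)‖ = s := norm_polarCoord_symm' hs1.1
    have hs2 : Complex.polarCoord.symm (s, θ) ∈ disc := mem_disc.2 (by rw [hn]; exact hs1.2)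
    have hs3 : ω (Complex.polarCoord.symm (s, θ)) = ω₀ (Complex.polarCoord.symm (s, θ)) :=
      not_not.1 hs hs2
    rw [hω.radial _ hs2, hn] at hs3
    exact hs3
  refine ⟨_, hW, h4, ?_⟩
  rw [ae_restrict_iff' measurableSet_Ioo] at h4
  have hM := measurableSet_toMeasurable volume
    {s : ℝ | ¬ (s ∈ Ioo 0 1 → ω (s : ℂ) = ω₀ (Complex.polarCoord.symm (s, θ)))}
  set M := toMeasurable volume
    {s : ℝ | ¬ (s ∈ Ioo 0 1 → ω (s : ℂ) = ω₀ (Complex.polarCoord.symm (s, θ)))} with hMdef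
  have hM0 : volume M = 0 := by rw [hMdef, measure_toMeasurable]; exact h4
  -- Conversely, a null set of radii sweeps out a null set of the plane; the half-width 4 exceeds π,
  -- so the sector is the whole punctured plane.
  have h5 := lintegral_sector_one (w := fun _ => 4) measurable_const
    (f := M.indicator 1) (measurable_one.indicator hM)
  have h6 : ∫⁻ s in Ioi (0 : ℝ), ENNReal.ofReal s * M.indicator 1 s *
      ENNReal.ofReal (2 * min 4 Real.pi) = 0 := by
    have : (fun s : ℝ => ENNReal.ofReal s * M.indicator 1 s *
      ENNReal.ofReal (2 * min 4 Real.pi)) =ᵐ[volume.restrict (Ioi 0)] 0 := by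
      refine ae_restrict_of_ae ?_
      filter_upwards [measure_eq_zero_iff_ae_notMem.1 hM0] with s hs
      rw [indicator_of_notMem hs]; simp
    rw [lintegral_congr_ae this]; simp
  have hMm : Measurable (fun z : ℂ => M.indicator (1 : ℝ → ℝ≥0∞) ‖z‖) :=
    (measurable_one.indicator hM).comp measurable_norm
  rw [h6, lintegral_eq_zero_iff hMm] at h5
  have h7 : ∀ᵐ z : ℂ, z ≠ 0 := by
    rw [ae_iff]; simp
  have h8 := (ae_restrict_iff' (measurableSet_sector 1 measurable_const)).1 h5
  rw [ae_restrict_iff' hd]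
  filter_upwards [h7, h8] with z hz hz8 hzd
  have hz1 : z ∈ sector 1 (fun _ => 4) :=
    ⟨hz, (angle_le_pi _ _).trans_lt Real.pi_lt_four⟩
  have hz2 := hz8 hz1
  have hz3 : ‖z‖ ∉ M := by
    intro h; simp [indicator_of_mem h] at hz2
  have hz4 : ‖z‖ ∉ {s : ℝ | ¬ (s ∈ Ioo 0 1 → ω (s : ℂ) = ω₀ (Complex.polarCoord.symm (s, θ)))} :=
    fun h => hz3 (subset_toMeasurable _ _ h)
  rw [hω.radial z hzd]
  exact not_not.1 hz4 ⟨norm_pos_iff.2 hz, mem_disc.1 hzd⟩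

theorem weightMeasure_apply (ω : ℂ → ℝ≥0) {S : Set ℂ} (hS : MeasurableSet S) :
    weightMeasure ω S = (ENNReal.ofReal Real.pi)⁻¹ * ∫⁻ z in S ∩ disc, (ω z : ℝ≥0∞) := by
  rw [weightMeasure, withDensity_apply _ hS, area, Measure.restrict_smul, lintegral_smul_measure,
    Measure.restrict_restrict hS, smul_eq_mul]

theorem weightMeasure_compl_disc (ω : ℂ → ℝ≥0) : weightMeasure ω discᶜ = 0 := by
  rw [weightMeasure_apply ω measurableSet_disc.compl]
  simp

theorem isFiniteMeasure_weightMeasure {ω : ℂ → ℝ≥0} (hω : IsDoublingWeight ω) :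
    IsFiniteMeasure (weightMeasure ω) := by
  refine ⟨?_⟩
  rw [weightMeasure_apply ω MeasurableSet.univ, univ_inter]
  exact ENNReal.mul_lt_top (ENNReal.inv_lt_top.2 (ENNReal.ofReal_pos.2 Real.pi_pos)) hω.integrable

theorem weightMeasure_sector {ω : ℂ → ℝ≥0} {W : ℝ → ℝ≥0} (hW : Measurable W)
    (h : ∀ᵐ z ∂(volume.restrict disc), ω z = W ‖z‖) {b : ℂ} (hb : b ≠ 0) {w : ℝ → ℝ}
    (hw : Measurable w) :
    weightMeasure ω (sector b w) = (ENNReal.ofReal Real.pi)⁻¹ *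
      ∫⁻ s in Ioo (0 : ℝ) 1, ENNReal.ofReal s * W s * ENNReal.ofReal (2 * min (w s) Real.pi) := by
  have hd := measurableSet_disc
  have hS := measurableSet_sector b hw
  rw [weightMeasure_apply ω hS]
  congr 1
  rw [← Measure.restrict_restrict hS,
    lintegral_congr_ae (g := fun z => (W ‖z‖ : ℝ≥0∞)) (ae_restrict_of_ae (by
      filter_upwards [h] with z hz; rw [hz])),
    Measure.restrict_restrict hS, inter_comm, ← Measure.restrict_restrict hd,
    ← lintegral_indicator hd]
  have e : ∀ z : ℂ, disc.indicator (fun z => (W ‖z‖ : ℝ≥0∞)) z =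
      (Iio (1 : ℝ)).indicator (fun s => (W s : ℝ≥0∞)) ‖z‖ := fun z => by
    by_cases hz : ‖z‖ < 1
    · rw [indicator_of_mem (mem_disc.2 hz), indicator_of_mem (show ‖z‖ ∈ Iio (1 : ℝ) from hz)]
    · rw [indicator_of_notMem (mt mem_disc.1 hz),
        indicator_of_notMem (show ‖z‖ ∉ Iio (1 : ℝ) from hz)]
  simp_rw [e]
  rw [lintegral_sector hb hw (hW.coe_nnreal_ennreal.indicator measurableSet_Iio)]
  have e2 : Ioo (0 : ℝ) 1 = Iio 1 ∩ Ioi 0 := by ext s; simp [and_comm]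
  rw [e2, ← Measure.restrict_restrict measurableSet_Iio, ← lintegral_indicator measurableSet_Iio]
  refine lintegral_congr fun s => ?_
  by_cases hs : s ∈ Iio (1 : ℝ)
  · simp only [indicator_of_mem hs]
  · simp only [indicator_of_notMem hs, mul_zero, zero_mul]

theorem weightMeasure_sector_le {ω : ℂ → ℝ≥0} {W : ℝ → ℝ≥0} (hW : Measurable W)
    (h : ∀ᵐ z ∂(volume.restrict disc), ω z = W ‖z‖)
    (h' : ∀ᵐ s : ℝ ∂(volume.restrict (Ioo (0 : ℝ) 1)), ω (s : ℂ) = W s) {b : ℂ} (hb : b ≠ 0)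
    {w : ℝ → ℝ} (hw : Measurable w) {c ρ : ℝ} (hwc : ∀ s ∈ Ioo (0 : ℝ) 1, w s ≤ c)
    (hwρ : ∀ s ∈ Ioo (0 : ℝ) 1, s ≤ ρ → w s ≤ 0) (hρ : 0 ≤ ρ) :
    weightMeasure ω (sector b w) ≤
      (ENNReal.ofReal Real.pi)⁻¹ * (ENNReal.ofReal (2 * c) * tail ω ρ) := by
  rw [weightMeasure_sector hW h hb hw]
  gcongr
  have hsub : Ioo ρ 1 ⊆ Ioo (0 : ℝ) 1 := Ioo_subset_Ioo_left hρ
  have e1 : tail ω ρ = ∫⁻ s in Ioo ρ 1, (W s : ℝ≥0∞) := by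
    refine lintegral_congr_ae ?_
    filter_upwards [ae_restrict_of_ae_restrict_of_subset hsub h'] with s hs
    rw [hs]
  rw [e1, ← lintegral_const_mul _ hW.coe_nnreal_ennreal, ← inter_eq_left.2 hsub,
    ← Measure.restrict_restrict measurableSet_Ioo,
    ← lintegral_indicator (measurableSet_Ioo (a := ρ) (b := 1))]
  refine setLIntegral_mono' measurableSet_Ioo fun s hs => ?_
  by_cases hsρ : s ≤ ρ
  · have : ENNReal.ofReal (2 * min (w s) Real.pi) = 0 := by
      rw [ENNReal.ofReal_eq_zero]
      have := min_le_left (w s) Real.pi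
      have := hwρ s hs hsρ
      linarith
    rw [this, mul_zero]; exact zero_le
  · rw [indicator_of_mem (show s ∈ Ioo ρ 1 from ⟨not_le.1 hsρ, hs.2⟩), mul_comm]
    have h1 : ENNReal.ofReal s ≤ 1 := ENNReal.ofReal_le_one.2 hs.2.le
    have h2 : 2 * min (w s) Real.pi ≤ 2 * c := by
      have := min_le_left (w s) Real.pi
      have := hwc s hs
      linarith
    gcongr
    exact mul_le_of_le_one_left zero_le h1

theorem le_weightMeasure_sector {ω : ℂ → ℝ≥0} {W : ℝ → ℝ≥0} (hW : Measurable W)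
    (h : ∀ᵐ z ∂(volume.restrict disc), ω z = W ‖z‖)
    (h' : ∀ᵐ s : ℝ ∂(volume.restrict (Ioo (0 : ℝ) 1)), ω (s : ℂ) = W s) {b : ℂ} (hb : b ≠ 0)
    {w : ℝ → ℝ} (hw : Measurable w) {c ρ : ℝ} (hρ : 0 ≤ ρ)
    (hwc : ∀ s ∈ Ioo ρ 1, c ≤ s * (2 * min (w s) Real.pi)) :
    (ENNReal.ofReal Real.pi)⁻¹ * (ENNReal.ofReal c * tail ω ρ) ≤
      weightMeasure ω (sector b w) := by
  rw [weightMeasure_sector hW h hb hw]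
  gcongr
  have hsub : Ioo ρ 1 ⊆ Ioo (0 : ℝ) 1 := Ioo_subset_Ioo_left hρ
  have e1 : tail ω ρ = ∫⁻ s in Ioo ρ 1, (W s : ℝ≥0∞) := by
    refine lintegral_congr_ae ?_
    filter_upwards [ae_restrict_of_ae_restrict_of_subset hsub h'] with s hs
    rw [hs]
  rw [e1, ← lintegral_const_mul _ hW.coe_nnreal_ennreal]
  refine le_trans ?_ (lintegral_mono_set hsub)
  refine setLIntegral_mono' measurableSet_Ioo fun s hs => ?_
  rw [mul_right_comm, ← ENNReal.ofReal_mul (hρ.trans hs.1.le)]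
  gcongr
  exact hwc s hs

/-! ### Doubling of tents from doubling of the tail -/

theorem tail_antitone (ω : ℂ → ℝ≥0) : Antitone (tail ω) := fun _ _ h =>
  lintegral_mono_set (Ioo_subset_Ioo_left h)

/-- A finite measure for which the boxes and the tents comparable to a tent have measure
comparable to that of the tent. -/
structure TentDoubling (μ : Measure ℂ) (K : ℝ≥0) : Prop where
  finite : IsFiniteMeasure μ
  compl_disc : μ discᶜ = 0
  pos : ∀ a ∈ disc, a ≠ 0 → μ (tent a) ≠ 0
  box_le : ∀ b ∈ disc, b ≠ 0 → μ (box b) ≤ K * μ (tent b)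
  tent_le : ∀ a ∈ disc, a ≠ 0 → ∀ b ∈ disc, b ≠ 0 → 1 - ‖a‖ ≤ 4 * (1 - ‖b‖) →
    μ (tent a) ≤ K * μ (tent b)

theorem tent_subset_sector (a : ℂ) : tent a ⊆ sector a (fun s => 1 / 2 * (1 - ‖a‖ / s)) :=
  fun _ h => ⟨(mem_tent.1 h).2.1, (mem_tent.1 h).2.2.2⟩

theorem sector_inter_disc_subset_tent {a : ℂ} (ha : a ≠ 0) :
    sector a (fun s => 1 / 2 * (1 - ‖a‖ / s)) ∩ disc ⊆ tent a :=
  fun _ h => mem_tent.2 ⟨mem_disc.1 h.2, h.1.1, ha, h.1.2⟩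

theorem box_subset_sector (b : ℂ) :
    box b ⊆ sector b ((Ioi (1 - 3 * (1 - ‖b‖))).indicator fun _ => 5 / 2 * (1 - ‖b‖)) := by
  rintro η ⟨_, h2, h3, h4⟩
  refine ⟨h2, ?_⟩
  rwa [indicator_of_mem (show ‖η‖ ∈ Ioi _ from h3)]

/-- Iterated doubling: if the tail vanishes anywhere before the boundary, it vanishes identically.
This yields positive mass of tents for a nonzero weight. -/
theorem tail_zero_le_pow {ω : ℂ → ℝ≥0} {C : ℝ≥0}
    (hC : ∀ r : ℝ, 0 ≤ r → r < 1 → tail ω r ≤ C * tail ω ((1 + r) / 2)) (n : ℕ) :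
    tail ω 0 ≤ C ^ n * tail ω (1 - (1 / 2) ^ n) := by
  induction n with
  | zero => simp
  | succ n ih =>
    have h1 : (0 : ℝ) < (1 / 2) ^ n := by positivity
    have h2 : ((1 : ℝ) / 2) ^ n ≤ 1 := pow_le_one₀ (by norm_num) (by norm_num)
    refine ih.trans ?_
    have h3 := hC (1 - (1 / 2) ^ n) (by linarith) (by linarith)
    have e : (1 + (1 - ((1 : ℝ) / 2) ^ n)) / 2 = 1 - (1 / 2) ^ (n + 1) := by rw [pow_succ]; ring
    rw [e] at h3
    rw [pow_succ, mul_assoc]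
    gcongr

/-- With δ = 1 - |b|, the tent has mass at least π⁻¹ (δ/2) times the tail at 1 - δ/2, while the box
and the comparable tents have mass at most π⁻¹ 5δ times the tail at max(0, 1 - 4δ). The widths
differ by the factor 10 and the tails by three doublings. -/
theorem IsDoublingWeight.exists_tentDoubling {ω : ℂ → ℝ≥0} (hω : IsDoublingWeight ω)
    (h0 : weightMeasure ω ≠ 0) : ∃ K : ℝ≥0, TentDoubling (weightMeasure ω) K := by
  obtain ⟨W, hW, h', h⟩ := hω.exists_profile
  obtain ⟨C, hC⟩ := hω.doubling
  have hpi := Real.pi_gt_three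
  have hpi0 : ENNReal.ofReal Real.pi ≠ 0 := (ENNReal.ofReal_pos.2 Real.pi_pos).ne'
  have hmt : ∀ a : ℂ, Measurable (fun s : ℝ => 1 / 2 * (1 - ‖a‖ / s)) := fun a => by fun_prop
  have hlow : ∀ b ∈ disc, b ≠ 0 → (ENNReal.ofReal Real.pi)⁻¹ *
      (ENNReal.ofReal ((1 - ‖b‖) / 2) * tail ω ((1 + ‖b‖) / 2)) ≤ weightMeasure ω (tent b) := by
    intro b hb hb0
    have hb1 := mem_disc.1 hb
    have hbn := norm_nonneg b
    refine (le_weightMeasure_sector hW h h' hb0 (hmt b) (by positivity)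
      (fun s hs => ?_)).trans ?_
    · have hs0 : 0 < s := by linarith [hs.1]
      have : 1 / 2 * (1 - ‖b‖ / s) ≤ Real.pi := by
        have : 0 ≤ ‖b‖ / s := by positivity
        linarith
      rw [min_eq_left this]
      have : s * (2 * (1 / 2 * (1 - ‖b‖ / s))) = s - ‖b‖ := by field_simp
      rw [this]; linarith [hs.1]
    · rw [← measure_inter_add_sdiff (sector b fun s => 1 / 2 * (1 - ‖b‖ / s)) measurableSet_disc]
      have : weightMeasure ω (sector b (fun s => 1 / 2 * (1 - ‖b‖ / s)) \ disc) = 0 :=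
        measure_mono_null (fun _ hx => hx.2) (weightMeasure_compl_disc ω)
      rw [this, add_zero]
      exact measure_mono (sector_inter_disc_subset_tent hb0)
  -- Three doublings: 1 - 4δ, 1 - 2δ, 1 - δ, 1 - δ/2. If 1 - 4δ ≤ 0, then |b| ≤ 3/4, and two
  -- doublings from 0 already reach 3/4.
  have htail : ∀ b ∈ disc, tail ω (max 0 (1 - 4 * (1 - ‖b‖))) ≤ C ^ 3 * tail ω ((1 + ‖b‖) / 2) := by
    intro b hb
    have hb1 := mem_disc.1 hb
    have hbn := norm_nonneg b
    have e1 := hC ‖b‖ hbn hb1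
    have hm : C ^ 2 * tail ω ‖b‖ ≤ (C : ℝ≥0∞) ^ 3 * tail ω ((1 + ‖b‖) / 2) := by
      rw [pow_succ (C : ℝ≥0∞) 2, mul_assoc]; gcongr
    refine le_trans ?_ hm
    rw [pow_two, mul_assoc]
    rcases le_total 0 (1 - 4 * (1 - ‖b‖)) with hc | hc
    · rw [max_eq_right hc]
      have e2 := hC _ hc (by linarith)
      have e3 := hC ((1 + (1 - 4 * (1 - ‖b‖))) / 2) (by linarith) (by linarith)
      have e : (1 + (1 + (1 - 4 * (1 - ‖b‖))) / 2) / 2 = ‖b‖ := by ring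
      rw [e] at e3
      exact e2.trans (by gcongr)
    · rw [max_eq_left hc]
      have e2 := hC 0 le_rfl one_pos
      have e3 := hC ((1 + 0) / 2) (by norm_num) (by norm_num)
      refine e2.trans ?_
      gcongr
      refine e3.trans ?_
      gcongr
      exact tail_antitone ω (by linarith)
  have hcomb : ∀ b ∈ disc, b ≠ 0 → (ENNReal.ofReal Real.pi)⁻¹ *
      (ENNReal.ofReal (2 * (5 / 2 * (1 - ‖b‖))) * tail ω (max 0 (1 - 4 * (1 - ‖b‖)))) ≤
      ((10 * C ^ 3 : ℝ≥0) : ℝ≥0∞) * weightMeasure ω (tent b) := by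
    intro b hb hb0
    have hb1 := mem_disc.1 hb
    calc _ ≤ (ENNReal.ofReal Real.pi)⁻¹ *
        (ENNReal.ofReal (2 * (5 / 2 * (1 - ‖b‖))) * (C ^ 3 * tail ω ((1 + ‖b‖) / 2))) := by
          gcongr; exact htail b hb
      _ = ((10 * C ^ 3 : ℝ≥0) : ℝ≥0∞) * ((ENNReal.ofReal Real.pi)⁻¹ *
        (ENNReal.ofReal ((1 - ‖b‖) / 2) * tail ω ((1 + ‖b‖) / 2))) := by
          have e : 2 * (5 / 2 * (1 - ‖b‖)) = 10 * ((1 - ‖b‖) / 2) := by ring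
          rw [e, ENNReal.ofReal_mul (by norm_num)]
          push_cast
          rw [show ENNReal.ofReal 10 = 10 by norm_num]
          ring
      _ ≤ _ := by gcongr; exact hlow b hb hb0
  refine ⟨10 * C ^ 3, isFiniteMeasure_weightMeasure hω, weightMeasure_compl_disc ω, ?_, ?_, ?_⟩
  · intro a ha ha0 hzero
    apply h0
    have ha1 := mem_disc.1 ha
    have h1 := hlow a ha ha0
    rw [hzero, nonpos_iff_eq_zero, mul_eq_zero, mul_eq_zero] at h1
    have h2 : tail ω ((1 + ‖a‖) / 2) = 0 := by
      rcases h1 with h1 | h1 | h1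
      · simp at h1
      · rw [ENNReal.ofReal_eq_zero] at h1; linarith
      · exact h1
    obtain ⟨n, hn⟩ := exists_pow_lt_of_lt_one (y := (1 / 2 : ℝ)) (x := (1 - ‖a‖) / 2)
      (by linarith) (by norm_num)
    have h3 : tail ω (1 - (1 / 2) ^ n) = 0 :=
      le_antisymm ((tail_antitone ω (by linarith)).trans h2.le) zero_le
    have h4 : tail ω 0 = 0 := by
      have := tail_zero_le_pow hC n
      rw [h3, mul_zero] at this
      exact le_antisymm this zero_le
    have h5 : weightMeasure ω (sector 1 fun _ => 4) = 0 := by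
      have := weightMeasure_sector_le hW h h' one_ne_zero (w := fun _ => 4) measurable_const
        (c := 4) (ρ := 0) (fun _ _ => le_rfl) (fun s hs hs' => absurd hs.1 (not_lt.2 hs')) le_rfl
      rw [h4, mul_zero, mul_zero] at this
      exact le_antisymm this zero_le
    have h6 : weightMeasure ω {0} = 0 := by
      rw [weightMeasure_apply ω (measurableSet_singleton 0)]
      have : volume ({0} ∩ disc) = 0 := measure_mono_null inter_subset_left (by simp)
      rw [setLIntegral_measure_zero _ _ this, mul_zero]
    rw [← Measure.measure_univ_eq_zero]
    refine measure_mono_null (t := (sector 1 fun _ => 4) ∪ {0}) (fun z _ => ?_)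
      (measure_union_null h5 h6)
    by_cases hz : z = 0
    · exact Or.inr hz
    · exact Or.inl ⟨hz, (angle_le_pi _ _).trans_lt Real.pi_lt_four⟩
  · intro b hb hb0
    have hb1 := mem_disc.1 hb
    refine (measure_mono (box_subset_sector b)).trans (le_trans ?_ (hcomb b hb hb0))
    refine weightMeasure_sector_le hW h h' hb0 (measurable_const.indicator measurableSet_Ioi)
      (fun s _ => ?_) (fun s hs hs' => ?_) (le_max_left _ _)
    · exact indicator_le_self' (fun _ _ => by linarith) s
    · rw [indicator_of_notMem]
      intro (hs3 : _ < s)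
      rcases le_max_iff.1 hs' with h1 | h1
      · linarith [hs.1]
      · linarith
  · intro a ha ha0 b hb hb0 hab
    have hb1 := mem_disc.1 hb
    have ha1 := mem_disc.1 ha
    refine (measure_mono (tent_subset_sector a)).trans (le_trans ?_ (hcomb b hb hb0))
    refine weightMeasure_sector_le hW h h' ha0 (hmt a)
      (fun s hs => ?_) (fun s hs hs' => ?_) (le_max_left _ _)
    · have : ‖a‖ ≤ ‖a‖ / s := by rw [le_div_iff₀ hs.1]; nlinarith [norm_nonneg a, hs.2]
      linarith
    · have : s ≤ ‖a‖ := hs'.trans (max_le (norm_nonneg a) (by linarith))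
      have : 1 ≤ ‖a‖ / s := by rw [le_div_iff₀ hs.1]; linarith
      linarith

/-! ### Layer-cake formulas -/

theorem lintegral_Ioo_rpow {r : ℝ} (hr : 0 < r) {a : ℝ} (ha : 0 ≤ a) :
    ∫⁻ t in Ioo 0 a, ENNReal.ofReal (r * t ^ (r - 1)) = ENNReal.ofReal (a ^ r) := by
  have h1 : IntervalIntegrable (fun t : ℝ => r * t ^ (r - 1)) volume 0 a :=
    (intervalIntegral.intervalIntegrable_rpow' (by linarith)).const_mul r
  rw [intervalIntegrable_iff_integrableOn_Ioo_of_le ha] at h1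
  rw [← ofReal_integral_eq_lintegral_ofReal h1]
  · rw [← integral_Ioc_eq_integral_Ioo, ← intervalIntegral.integral_of_le ha,
      intervalIntegral.integral_const_mul, integral_rpow (Or.inl (by linarith))]
    congr 1
    rw [sub_add_cancel, Real.zero_rpow hr.ne']
    field_simp; ring
  · filter_upwards [ae_restrict_mem measurableSet_Ioo] with t ht
    have := ht.1.le
    simp only [Pi.zero_apply]; positivity

theorem lintegral_indicator_rpow (x : ℝ≥0∞) {r : ℝ} (hr : 0 < r) :
    ∫⁻ t in Ioi (0 : ℝ), {t : ℝ | ENNReal.ofReal t < x}.indicator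
      (fun t => ENNReal.ofReal (r * t ^ (r - 1))) t = x ^ r := by
  have key : ∀ a : ℝ, 0 ≤ a → ∫⁻ t in Ioi (0 : ℝ), {t : ℝ | ENNReal.ofReal t <
      ENNReal.ofReal a}.indicator (fun t => ENNReal.ofReal (r * t ^ (r - 1))) t =
      ENNReal.ofReal a ^ r := by
    intro a ha
    have hm : MeasurableSet {t : ℝ | ENNReal.ofReal t < ENNReal.ofReal a} :=
      measurableSet_lt ENNReal.measurable_ofReal measurable_const
    rw [lintegral_indicator hm, Measure.restrict_restrict hm,
      ENNReal.ofReal_rpow_of_nonneg ha hr.le, ← lintegral_Ioo_rpow hr ha]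
    congr 2
    ext t
    change ENNReal.ofReal t < ENNReal.ofReal a ∧ 0 < t ↔ 0 < t ∧ t < a
    constructor
    · rintro ⟨h1, h2⟩
      exact ⟨h2, (ENNReal.ofReal_lt_ofReal_iff_of_nonneg h2.le).1 h1⟩
    · rintro ⟨h1, h2⟩
      exact ⟨(ENNReal.ofReal_lt_ofReal_iff_of_nonneg h1.le).2 h2, h1⟩
  by_cases hx : x = ∞
  · rw [hx, ENNReal.top_rpow_of_pos hr]
    refine ENNReal.eq_top_of_forall_nnreal_le fun c => ?_
    have h1 := key ((c : ℝ) ^ (1 / r)) (by positivity)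
    rw [ENNReal.ofReal_rpow_of_nonneg (by positivity) hr.le, ← Real.rpow_mul (NNReal.coe_nonneg c),
      one_div_mul_cancel hr.ne', Real.rpow_one, ENNReal.ofReal_coe_nnreal] at h1
    rw [← h1]
    refine lintegral_mono fun t => ?_
    have hsub : {t : ℝ | ENNReal.ofReal t < ENNReal.ofReal ((c : ℝ) ^ (1 / r))} ⊆
        {t : ℝ | ENNReal.ofReal t < ∞} := by
      intro t _
      exact ENNReal.ofReal_lt_top
    exact indicator_le_indicator_of_subset hsub (fun _ => zero_le) t
  · rw [← ENNReal.ofReal_toReal hx]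
    exact key _ ENNReal.toReal_nonneg

/-- The extra weight φ serves the maximal theorem, where a power of φ is integrated against φ dμ. -/
theorem lintegral_mul_rpow_eq {μ : Measure ℂ} [SFinite μ] {φ F : ℂ → ℝ≥0∞} (hφ : Measurable φ)
    (hF : Measurable F) {r : ℝ} (hr : 0 < r) :
    ∫⁻ ζ, φ ζ * F ζ ^ r ∂μ = ∫⁻ t in Ioi (0 : ℝ), ENNReal.ofReal (r * t ^ (r - 1)) *
      ∫⁻ ζ in {ζ | ENNReal.ofReal t < F ζ}, φ ζ ∂μ := by
  have hm : Measurable (fun t : ℝ => ENNReal.ofReal (r * t ^ (r - 1))) := by fun_prop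
  have hE : MeasurableSet {p : ℂ × ℝ | ENNReal.ofReal p.2 < F p.1} :=
    measurableSet_lt (ENNReal.measurable_ofReal.comp measurable_snd) (hF.comp measurable_fst)
  simp_rw [← lintegral_indicator_rpow _ hr]
  have e1 : ∀ ζ, φ ζ * ∫⁻ t in Ioi (0 : ℝ), {t : ℝ | ENNReal.ofReal t < F ζ}.indicator
      (fun t => ENNReal.ofReal (r * t ^ (r - 1))) t =
      ∫⁻ t in Ioi (0 : ℝ), {p : ℂ × ℝ | ENNReal.ofReal p.2 < F p.1}.indicator
        (fun p => φ p.1 * ENNReal.ofReal (r * p.2 ^ (r - 1))) (ζ, t) := by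
    intro ζ
    rw [← lintegral_const_mul _ (hm.indicator
      (measurableSet_lt ENNReal.measurable_ofReal measurable_const))]
    refine lintegral_congr fun t => ?_
    by_cases h : ENNReal.ofReal t < F ζ
    · rw [indicator_of_mem (show t ∈ {t : ℝ | ENNReal.ofReal t < F ζ} from h),
        indicator_of_mem (show (ζ, t) ∈ {p : ℂ × ℝ | ENNReal.ofReal p.2 < F p.1} from h)]
    · rw [indicator_of_notMem (show t ∉ {t : ℝ | ENNReal.ofReal t < F ζ} from h),
        indicator_of_notMem (show (ζ, t) ∉ {p : ℂ × ℝ | ENNReal.ofReal p.2 < F p.1} from h),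
        mul_zero]
  simp_rw [e1]
  have hmm : Measurable (fun p : ℂ × ℝ => φ p.1 * ENNReal.ofReal (r * p.2 ^ (r - 1))) :=
    (hφ.comp measurable_fst).mul (hm.comp measurable_snd)
  rw [lintegral_lintegral_swap (f := fun ζ t => {p : ℂ × ℝ | ENNReal.ofReal p.2 < F p.1}.indicator
        (fun p => φ p.1 * ENNReal.ofReal (r * p.2 ^ (r - 1))) (ζ, t))
        (hmm.indicator hE).aemeasurable]
  refine lintegral_congr fun t => ?_
  have hEt : MeasurableSet {ζ | ENNReal.ofReal t < F ζ} := measurableSet_lt measurable_const hF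
  rw [← lintegral_indicator hEt, ← lintegral_const_mul _ (hφ.indicator hEt)]
  refine lintegral_congr fun ζ => ?_
  by_cases h : ENNReal.ofReal t < F ζ
  · rw [indicator_of_mem (show ζ ∈ {ζ | ENNReal.ofReal t < F ζ} from h),
      indicator_of_mem (show (ζ, t) ∈ {p : ℂ × ℝ | ENNReal.ofReal p.2 < F p.1} from h), mul_comm]
  · rw [indicator_of_notMem (show ζ ∉ {ζ | ENNReal.ofReal t < F ζ} from h),
      indicator_of_notMem (show (ζ, t) ∉ {p : ℂ × ℝ | ENNReal.ofReal p.2 < F p.1} from h),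
      mul_zero]

theorem lintegral_rpow_eq_meas_lt {μ : Measure ℂ} [SFinite μ] {F : ℂ → ℝ≥0∞}
    (hF : Measurable F) {r : ℝ} (hr : 0 < r) :
    ∫⁻ ζ, F ζ ^ r ∂μ = ∫⁻ t in Ioi (0 : ℝ), ENNReal.ofReal (r * t ^ (r - 1)) *
      μ {ζ | ENNReal.ofReal t < F ζ} := by
  simpa using lintegral_mul_rpow_eq (μ := μ) (φ := fun _ => 1) measurable_const hF hr

/-! ### Lens suprema and the maximal theorem -/

/-- The supremum of a function over the lens at a point. -/
noncomputable def lensSup (X : ℂ → ℝ≥0∞) (ζ : ℂ) : ℝ≥0∞ := ⨆ z ∈ lens ζ, X z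

theorem setOf_lt_lensSup (X : ℂ → ℝ≥0∞) (t : ℝ≥0∞) :
    {ζ | t < lensSup X ζ} = ⋃ z ∈ {z | t < X z}, {ζ | z ∈ lens ζ} := by
  ext ζ
  simp only [lensSup, mem_iUnion]
  change t < _ ↔ _
  simp only [lt_iSup_iff]
  constructor
  · rintro ⟨z, hz, h⟩; exact ⟨z, h, hz⟩
  · rintro ⟨z, h, hz⟩; exact ⟨z, hz, h⟩

/-- The superlevel sets are unions of open sets, so X need not be measurable. -/
theorem measurable_lensSup (X : ℂ → ℝ≥0∞) : Measurable (lensSup X) := by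
  refine measurable_of_Ioi fun t => ?_
  have : lensSup X ⁻¹' Ioi t = {ζ | t < lensSup X ζ} := rfl
  rw [this, setOf_lt_lensSup]
  exact (isOpen_biUnion fun z _ =>
    isOpen_lens_rel.preimage (f := fun ζ => (ζ, z)) (by fun_prop)).measurableSet

theorem setOf_lt_lensSup_subset (X : ℂ → ℝ≥0∞) (t : ℝ≥0∞) :
    {ζ | t < lensSup X ζ} ⊆ discᶜ ∪ ⋃ a ∈ {z | (z ∈ disc ∧ z ≠ 0) ∧ t < X z}, tent a := by
  rw [setOf_lt_lensSup]
  intro ζ h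
  obtain ⟨z, hz, hζ⟩ := mem_iUnion₂.1 h
  by_cases hd : ζ ∈ disc
  · have hzt : ζ ∈ tent z := ⟨hd, hζ⟩
    exact Or.inr (mem_iUnion₂.2
      ⟨z, ⟨⟨mem_disc_of_mem_tent hzt, ne_zero_of_mem_tent hzt⟩, hz⟩, hzt⟩)
  · exact Or.inl hd

/-- A covering inequality: domination on boxes and on tents passes to unions of tents. -/
theorem measure_biUnion_tent_le {μ ρ l : Measure ℂ} {S : Set ℂ}
    (hS : ∀ a ∈ S, a ∈ disc ∧ a ≠ 0) {M c : ℝ≥0∞}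
    (hl : ∀ b ∈ S, l (box b) ≤ M * μ (tent b)) (hρ : ∀ a ∈ S, μ (tent a) ≤ c * ρ (tent a)) :
    l (⋃ a ∈ S, insert a (tent a)) ≤ M * c * ρ (⋃ a ∈ S, tent a) := by
  obtain ⟨u, hu, hc, hd, hcov⟩ := exists_disjoint_tents S hS
  calc l (⋃ a ∈ S, insert a (tent a)) ≤ l (⋃ b ∈ u, box b) := measure_mono hcov
    _ ≤ ∑' b : u, l (box b) := measure_biUnion_le l hc box
    _ ≤ ∑' b : u, M * c * ρ (tent b) := ENNReal.tsum_le_tsum fun b => by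
        rw [mul_assoc]
        exact (hl b (hu b.2)).trans (by gcongr; exact hρ b (hu b.2))
    _ = M * c * ρ (⋃ b ∈ u, tent b) := by
        rw [ENNReal.tsum_mul_left, measure_biUnion hc hd fun b _ => (isOpen_tent b).measurableSet]
    _ ≤ _ := mul_le_mul_right (measure_mono (biUnion_subset_biUnion_left hu)) _

/-- If the level sets of `X` have tents half filled by those of `A`, then the lens supremum of `X`
is controlled by `A` in every `L^s`. -/
theorem TentDoubling.lintegral_lensSup_rpow_le {μ : Measure ℂ} {K : ℝ≥0} (hμ : TentDoubling μ K)
    {X A : ℂ → ℝ≥0∞} (hA : Measurable A)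
    (h : ∀ z ∈ disc, z ≠ 0 → ∀ t : ℝ, 0 < t → ENNReal.ofReal t < X z →
      μ (tent z) ≤ 2 * μ (tent z ∩ {ζ | ENNReal.ofReal t < 2 * A ζ})) {s : ℝ} (hs : 0 < s) :
    ∫⁻ ζ, lensSup X ζ ^ s ∂μ ≤ K * 2 * 2 ^ s * ∫⁻ ζ, A ζ ^ s ∂μ := by
  have := hμ.finite
  have e : ∫⁻ ζ, (2 * A ζ) ^ s ∂μ = 2 ^ s * ∫⁻ ζ, A ζ ^ s ∂μ := by
    simp_rw [ENNReal.mul_rpow_of_nonneg _ _ hs.le]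
    rw [lintegral_const_mul _ (hA.pow_const s)]
  rw [mul_assoc, ← e, lintegral_rpow_eq_meas_lt (measurable_lensSup X) hs,
    lintegral_rpow_eq_meas_lt (hA.const_mul 2) hs, ← lintegral_const_mul' _ _
    (ENNReal.mul_ne_top ENNReal.coe_ne_top ENNReal.ofNat_ne_top)]
  refine setLIntegral_mono' measurableSet_Ioi fun t ht => ?_
  rw [mul_left_comm]
  gcongr
  have hm : MeasurableSet {ζ | ENNReal.ofReal t < 2 * A ζ} :=
    measurableSet_lt measurable_const (hA.const_mul 2)
  have h1 := measure_biUnion_tent_le (l := μ) (μ := μ)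
    (ρ := μ.restrict {ζ | ENNReal.ofReal t < 2 * A ζ})
    (S := {z | (z ∈ disc ∧ z ≠ 0) ∧ ENNReal.ofReal t < X z}) (fun a ha => ha.1)
    (M := K) (c := 2) (fun b hb => hμ.box_le b hb.1.1 hb.1.2) (fun a ha => by
      rw [Measure.restrict_apply (isOpen_tent a).measurableSet]
      exact h a ha.1.1 ha.1.2 t ht ha.2)
  calc _ ≤ μ discᶜ + μ (⋃ a ∈ {z | (z ∈ disc ∧ z ≠ 0) ∧ ENNReal.ofReal t < X z}, tent a) :=
        (measure_mono (setOf_lt_lensSup_subset X _)).trans (measure_union_le _ _)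
    _ ≤ 0 + μ (⋃ a ∈ {z | (z ∈ disc ∧ z ≠ 0) ∧ ENNReal.ofReal t < X z}, insert a (tent a)) := by
        rw [hμ.compl_disc]; gcongr; exact subset_insert _ _
    _ ≤ _ := by
        rw [zero_add]
        refine h1.trans ?_
        refine mul_le_mul_right ((measure_mono (subset_univ _)).trans ?_) _
        rw [Measure.restrict_apply_univ]

/-- The mean of a function over a tent. -/
noncomputable def tentAvg (μ : Measure ℂ) (φ : ℂ → ℝ≥0∞) (z : ℂ) : ℝ≥0∞ :=
  (∫⁻ ζ in tent z, φ ζ ∂μ) / μ (tent z)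

/-- Weak-type bound: where φ ≤ t/2 it contributes at most t/2 to a mean exceeding t, so the rest
contributes at least t/2. The covering inequality is applied with φ dμ restricted to {2φ > t}. -/
theorem TentDoubling.measure_lt_lensSup_tentAvg_le {μ : Measure ℂ} {K : ℝ≥0}
    (hμ : TentDoubling μ K) {φ : ℂ → ℝ≥0∞} (hφ : Measurable φ) {t : ℝ} (ht : 0 < t) :
    μ {ζ | ENNReal.ofReal t < lensSup (tentAvg μ φ) ζ} ≤
      K * (ENNReal.ofReal (t / 2))⁻¹ * ∫⁻ ζ in {ζ | ENNReal.ofReal t < 2 * φ ζ}, φ ζ ∂μ := by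
  have := hμ.finite
  set E := {ζ | ENNReal.ofReal t < 2 * φ ζ} with hE
  have hm : MeasurableSet E := measurableSet_lt measurable_const (hφ.const_mul 2)
  have h20 : ENNReal.ofReal (t / 2) ≠ 0 := (ENNReal.ofReal_pos.2 (by positivity)).ne'
  have ht2 : ENNReal.ofReal t = 2 * ENNReal.ofReal (t / 2) := by
    rw [← ENNReal.ofReal_ofNat, ← ENNReal.ofReal_mul (by norm_num)]; congr 1; ring
  have h1 := measure_biUnion_tent_le (l := μ) (μ := μ)
    (ρ := (μ.restrict E).withDensity φ)
    (S := {z | (z ∈ disc ∧ z ≠ 0) ∧ ENNReal.ofReal t < tentAvg μ φ z}) (fun a ha => ha.1)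
    (M := K) (c := (ENNReal.ofReal (t / 2))⁻¹) (fun b hb => hμ.box_le b hb.1.1 hb.1.2)
    (fun a ha => by
      have hta := (isOpen_tent a).measurableSet
      have hfin : μ (tent a) ≠ ∞ := measure_ne_top μ _
      have ha2 := ha.2
      rw [withDensity_apply _ hta, Measure.restrict_restrict hta,
        ← ENNReal.mul_le_iff_le_inv h20 ENNReal.ofReal_ne_top]
      have h2 := ENNReal.mul_le_of_le_div ha2.le
      have h3 : ∫⁻ ζ in tent a \ E, φ ζ ∂μ ≤ ENNReal.ofReal (t / 2) * μ (tent a) := by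
        calc _ ≤ ∫⁻ _ in tent a \ E, ENNReal.ofReal (t / 2) ∂μ := by
              refine setLIntegral_mono' (hta.diff hm) fun ζ hζ => ?_
              have h4 : 2 * φ ζ ≤ 2 * ENNReal.ofReal (t / 2) := ht2 ▸ not_lt.1 hζ.2
              exact (ENNReal.mul_le_mul_iff_right two_ne_zero ENNReal.ofNat_ne_top).1 h4
          _ ≤ _ := by
              rw [setLIntegral_const]; gcongr; exact sdiff_subset
      rw [← lintegral_inter_add_sdiff φ (tent a) hm, ht2, mul_assoc, two_mul] at h2
      exact ENNReal.le_of_add_le_add_right (ENNReal.mul_ne_top ENNReal.ofReal_ne_top hfin)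
        (h2.trans (add_le_add_right h3 _)))
  calc _ ≤ μ discᶜ +
          μ (⋃ a ∈ {z | (z ∈ disc ∧ z ≠ 0) ∧ ENNReal.ofReal t < tentAvg μ φ z}, tent a) :=
        (measure_mono (setOf_lt_lensSup_subset _ _)).trans (measure_union_le _ _)
    _ ≤ 0 + μ (⋃ a ∈ {z | (z ∈ disc ∧ z ≠ 0) ∧ ENNReal.ofReal t < tentAvg μ φ z},
          insert a (tent a)) := by
        rw [hμ.compl_disc]; gcongr; exact subset_insert _ _
    _ ≤ _ := by
        rw [zero_add]
        refine h1.trans ?_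
        gcongr
        refine (measure_mono (subset_univ _)).trans ?_
        rw [withDensity_apply _ MeasurableSet.univ, Measure.restrict_univ]

/-- Integrate the weak-type bound against r t^(r-1). Its factor 2/t lowers the power to t^(r-2),
which is integrable at 0 because r > 1 and gives the factor 2r/(r-1). -/
theorem TentDoubling.exists_lintegral_lensSup_tentAvg_le {μ : Measure ℂ} {K : ℝ≥0}
    (hμ : TentDoubling μ K) {r : ℝ} (hr : 1 < r) :
    ∃ C : ℝ≥0, ∀ φ : ℂ → ℝ≥0∞, Measurable φ →
      ∫⁻ ζ, lensSup (tentAvg μ φ) ζ ^ r ∂μ ≤ C * ∫⁻ ζ, φ ζ ^ r ∂μ := by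
  have := hμ.finite
  refine ⟨K * Real.toNNReal (2 * r / (r - 1)) * Real.toNNReal (2 ^ (r - 1)), fun φ hφ => ?_⟩
  have hr0 : 0 < r - 1 := by linarith
  have h1 := lintegral_mul_rpow_eq (μ := μ) hφ (hφ.const_mul 2) hr0
  have e : ∫⁻ ζ, φ ζ * (2 * φ ζ) ^ (r - 1) ∂μ = 2 ^ (r - 1) * ∫⁻ ζ, φ ζ ^ r ∂μ := by
    rw [← lintegral_const_mul _ (hφ.pow_const r)]
    refine lintegral_congr fun ζ => ?_
    rw [ENNReal.mul_rpow_of_nonneg _ _ hr0.le, mul_left_comm]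
    congr 1
    nth_rewrite 1 [← ENNReal.rpow_one (φ ζ)]
    rw [← ENNReal.rpow_add_of_nonneg _ _ zero_le_one hr0.le]
    congr 1; ring
  have e2 : (2 : ℝ≥0∞) ^ (r - 1) = ENNReal.ofReal (2 ^ (r - 1)) := by
    rw [← ENNReal.ofReal_rpow_of_nonneg (by norm_num) hr0.le]; norm_num
  rw [lintegral_rpow_eq_meas_lt (measurable_lensSup _) (by linarith)]
  push_cast
  change _ ≤ (K : ℝ≥0∞) * ENNReal.ofReal (2 * r / (r - 1)) * ENNReal.ofReal (2 ^ (r - 1)) * _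
  rw [← e2, mul_assoc, ← e, h1, ← lintegral_const_mul' _ _
    (ENNReal.mul_ne_top ENNReal.coe_ne_top ENNReal.ofReal_ne_top)]
  refine setLIntegral_mono' measurableSet_Ioi fun t (ht : 0 < t) => ?_
  refine (mul_le_mul_right (hμ.measure_lt_lensSup_tentAvg_le hφ ht) _).trans (le_of_eq ?_)
  have e3 : ENNReal.ofReal (r * t ^ (r - 1)) * (ENNReal.ofReal (t / 2))⁻¹ =
      ENNReal.ofReal (2 * r / (r - 1)) * ENNReal.ofReal ((r - 1) * t ^ (r - 1 - 1)) := by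
    rw [← ENNReal.ofReal_inv_of_pos (by positivity), ← ENNReal.ofReal_mul (by positivity),
      ← ENNReal.ofReal_mul (by positivity), Real.rpow_sub_one ht.ne' (r - 1)]
    congr 1; field_simp
  calc _ = (K : ℝ≥0∞) * (ENNReal.ofReal (r * t ^ (r - 1)) * (ENNReal.ofReal (t / 2))⁻¹) *
      ∫⁻ ζ in {ζ | ENNReal.ofReal t < 2 * φ ζ}, φ ζ ∂μ := by ring
    _ = _ := by rw [e3]; ring

/-! ### Measurability and essential suprema over lenses -/

theorem IsDiscMeasure.sigmaFinite {ν : Measure ℂ} (hν : IsDiscMeasure ν) : SigmaFinite ν := by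
  refine ⟨⟨⟨fun n => Metric.closedBall 0 (1 - 1 / ((n : ℝ) + 1)) ∪ discᶜ, fun _ => trivial,
    fun n => ?_, ?_⟩⟩⟩
  · refine (measure_union_le _ _).trans_lt ?_
    rw [hν.compl_disc, add_zero]
    refine hν.finite_compact _ (fun z hz => ?_) (isCompact_closedBall _ _)
    rw [mem_closedBall_zero_iff] at hz
    have : 0 < 1 / ((n : ℝ) + 1) := by positivity
    exact mem_disc.2 (by linarith)
  · refine eq_univ_of_forall fun z => ?_
    by_cases hz : z ∈ disc
    · obtain ⟨n, hn⟩ := exists_nat_one_div_lt (sub_pos.2 (mem_disc.1 hz))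
      refine mem_iUnion.2 ⟨n, Or.inl ?_⟩
      rw [mem_closedBall_zero_iff]; linarith
    · exact mem_iUnion.2 ⟨0, Or.inr hz⟩

theorem measurable_measure_tent (μ : Measure ℂ) [SFinite μ] : Measurable fun z => μ (tent z) :=
  measurable_measure_prodMk_right isOpen_tent_rel.measurableSet

theorem measurable_measure_lens_inter (ν : Measure ℂ) [SFinite ν] {E : Set ℂ}
    (hE : MeasurableSet E) : Measurable fun ζ => ν (lens ζ ∩ E) :=
  measurable_measure_prodMk_left (s := {x : ℂ × ℂ | x.2 ∈ lens x.1} ∩ Prod.snd ⁻¹' E)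
    (isOpen_lens_rel.measurableSet.inter (measurable_snd hE))

theorem measurable_lintegral_lens (ν : Measure ℂ) [SFinite ν] {F : ℂ → ℝ≥0∞}
    (hF : Measurable F) : Measurable fun ζ => ∫⁻ z in lens ζ, F z ∂ν := by
  have h1 : Measurable ({x : ℂ × ℂ | x.2 ∈ lens x.1}.indicator fun x => F x.2) :=
    (hF.comp measurable_snd).indicator isOpen_lens_rel.measurableSet
  have h2 := h1.lintegral_prod_right' (ν := ν)
  convert h2 using 2 with ζ
  rw [← lintegral_indicator (isOpen_lens ζ).measurableSet]
  rfl

theorem measurable_lintegral_tent (μ : Measure ℂ) [SFinite μ] {F : ℂ → ℝ≥0∞}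
    (hF : Measurable F) : Measurable fun z => ∫⁻ ζ in tent z, F ζ ∂μ := by
  have h1 : Measurable ({x : ℂ × ℂ | x.1 ∈ tent x.2}.indicator fun x => F x.1) :=
    (hF.comp measurable_fst).indicator isOpen_tent_rel.measurableSet
  have h2 := h1.lintegral_prod_left' (μ := μ)
  convert h2 using 2 with z
  rw [← lintegral_indicator (isOpen_tent z).measurableSet]
  rfl

theorem measurable_tentAvg (μ : Measure ℂ) [SFinite μ] {F : ℂ → ℝ≥0∞} (hF : Measurable F) :
    Measurable (tentAvg μ F) :=
  (measurable_lintegral_tent μ hF).div (measurable_measure_tent μ)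

theorem lt_essSup_lens_iff {ν : Measure ℂ} {X : ℂ → ℝ≥0∞} {c : ℝ≥0∞} {ζ : ℂ} :
    c < essSup X (ν.restrict (lens ζ)) ↔ 0 < ν (lens ζ ∩ {z | c < X z}) := by
  rw [← not_le, pos_iff_ne_zero, not_iff_not]
  have h1 : ν (lens ζ ∩ {z | c < X z}) = ν.restrict (lens ζ) {z | c < X z} := by
    rw [Measure.restrict_apply' (isOpen_lens ζ).measurableSet, inter_comm]
  rw [h1]
  constructor
  · intro h
    have h2 : ∀ᵐ z ∂(ν.restrict (lens ζ)), X z ≤ c := (ENNReal.ae_le_essSup X).mono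
      fun z hz => hz.trans h
    simpa only [ae_iff, not_le] using h2
  · intro h
    refine essSup_le_of_ae_le c ?_
    change ∀ᵐ z ∂(ν.restrict (lens ζ)), X z ≤ c
    simpa only [ae_iff, not_le] using h

theorem measurable_essSup_lens (ν : Measure ℂ) [SFinite ν] {X : ℂ → ℝ≥0∞} (hX : Measurable X) :
    Measurable fun ζ => essSup X (ν.restrict (lens ζ)) := by
  refine measurable_of_Ioi fun c => ?_
  have : (fun ζ => essSup X (ν.restrict (lens ζ))) ⁻¹' Ioi c =
      (fun ζ => ν (lens ζ ∩ {z | c < X z})) ⁻¹' Ioi 0 := by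
    ext ζ; exact lt_essSup_lens_iff
  rw [this]
  exact measurable_measure_lens_inter ν (measurableSet_lt measurable_const hX) measurableSet_Ioi

/-! ### The Carleson embedding -/

/-- At almost every point where `X > c`, the essential supremum over the lenses exceeds `c` on the
whole tent. -/
theorem ae_lt_essSup_lens (ν : Measure ℂ) (X : ℂ → ℝ≥0∞) (c : ℝ≥0∞) :
    ∀ᵐ z ∂ν, c < X z → ∀ ζ, z ∈ lens ζ → c < essSup X (ν.restrict (lens ζ)) := by
  -- Lindelöf: the union of uncountably many open lenses equals a countable subunion, so the
  -- exceptional sets together stay null.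
  obtain ⟨v, hvs, hvc, hv⟩ := TopologicalSpace.isOpen_biUnion_countable
    {ζ | essSup X (ν.restrict (lens ζ)) ≤ c} lens fun ζ _ => isOpen_lens ζ
  have h0 : ν (⋃ ζ ∈ v, lens ζ ∩ {z | c < X z}) = 0 := by
    refine (measure_biUnion_null_iff hvc).2 fun ζ hζ => ?_
    by_contra h
    exact not_lt.2 (hvs hζ) (lt_essSup_lens_iff.2 (pos_iff_ne_zero.2 h))
  filter_upwards [measure_eq_zero_iff_ae_notMem.1 h0] with z hz hc ζ hζ
  by_contra h
  have h1 : z ∈ ⋃ ζ ∈ {ζ | essSup X (ν.restrict (lens ζ)) ≤ c}, lens ζ :=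
    mem_iUnion₂.2 ⟨ζ, not_lt.1 h, hζ⟩
  rw [← hv] at h1
  obtain ⟨ζ', h2, h3⟩ := mem_iUnion₂.1 h1
  exact hz (mem_iUnion₂.2 ⟨ζ', h2, h3, hc⟩)

/-- The part of the box with |η| ≥ 2ε is covered by 21 tents comparable to T(b), with a bound
independent of ε. The box omits the origin, so letting ε tend to 0 exhausts it. -/
theorem TentDoubling.box_le_of_tent_le {μ l : Measure ℂ} {K : ℝ≥0} (hμ : TentDoubling μ K)
    {N : ℝ≥0∞} (hl : ∀ a ∈ disc, a ≠ 0 → l (tent a) ≤ N * μ (tent a)) {b : ℂ} (hb : b ∈ disc)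
    (h0 : b ≠ 0) : l (box b) ≤ 21 * N * K * μ (tent b) := by
  let ε : ℕ → ℝ := fun n => 1 / ((n : ℝ) + 2)
  have hmono : Monotone fun n => box b ∩ {η | 2 * ε n ≤ ‖η‖} := by
    intro m n hmn η hη
    refine ⟨hη.1, le_trans (b := 2 * ε m) ?_ hη.2⟩
    change 2 * ε n ≤ 2 * ε m
    have : (m : ℝ) ≤ n := by exact_mod_cast hmn
    simp only [ε]; gcongr
  have hU : box b ⊆ ⋃ n, box b ∩ {η | 2 * ε n ≤ ‖η‖} := by
    intro η hη
    obtain ⟨n, hn⟩ := exists_nat_one_div_lt (half_pos (norm_pos_iff.2 (box_ne_zero hη)))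
    refine mem_iUnion.2 ⟨n, hη, ?_⟩
    change 2 * ε n ≤ ‖η‖
    have : ε n ≤ 1 / ((n : ℝ) + 1) := by simp only [ε]; gcongr; norm_num
    linarith
  refine (measure_mono hU).trans ?_
  rw [hmono.measure_iUnion]
  refine iSup_le fun n => ?_
  have hn : (0 : ℝ) ≤ n := Nat.cast_nonneg n
  obtain ⟨a, ha, hcov⟩ := box_subset_iUnion_tent hb h0 (ε := ε n) (by positivity) (by
    simp only [ε]; rw [div_lt_one (by positivity)]; linarith)
  calc _ ≤ l (⋃ j ∈ Finset.Icc (-10 : ℤ) 10, tent (a j)) := measure_mono hcov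
    _ ≤ ∑ j ∈ Finset.Icc (-10 : ℤ) 10, l (tent (a j)) := measure_biUnion_finset_le _ _
    _ ≤ ∑ j ∈ Finset.Icc (-10 : ℤ) 10, N * (K * μ (tent b)) := by
        refine Finset.sum_le_sum fun j _ => ?_
        obtain ⟨h1, h2, h3⟩ := ha j
        refine (hl _ h1 h2).trans ?_
        gcongr
        exact hμ.tent_le _ h1 h2 b hb h0 h3
    _ = _ := by
        rw [Finset.sum_const]
        rw [show (Finset.Icc (-10 : ℤ) 10).card = 21 from rfl, nsmul_eq_mul]
        push_cast
        ring

/-- The Carleson embedding. -/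
theorem TentDoubling.lintegral_le_of_tent_le {μ : Measure ℂ} {K : ℝ≥0} (hμ : TentDoubling μ K)
    {ν l : Measure ℂ} [SFinite ν] [SFinite l] (hac : l ≪ ν) (hl0 : ∀ᵐ z ∂l, z ∈ disc ∧ z ≠ 0)
    {N : ℝ≥0} (hl : ∀ a ∈ disc, a ≠ 0 → l (tent a) ≤ N * μ (tent a)) {X : ℂ → ℝ≥0∞}
    (hX : Measurable X) :
    ∫⁻ z, X z ∂l ≤ 21 * N * K * ∫⁻ ζ, essSup X (ν.restrict (lens ζ)) ∂μ := by
  have := hμ.finite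
  have h1 := lintegral_rpow_eq_meas_lt (μ := l) hX one_pos
  have h2 := lintegral_rpow_eq_meas_lt (μ := μ) (measurable_essSup_lens ν hX) one_pos
  simp only [ENNReal.rpow_one] at h1 h2
  have hc : (21 * N * K : ℝ≥0∞) ≠ ∞ := ENNReal.mul_ne_top
    (ENNReal.mul_ne_top ENNReal.ofNat_ne_top ENNReal.coe_ne_top) ENNReal.coe_ne_top
  rw [h1, h2, ← lintegral_const_mul' _ _ hc]
  refine lintegral_mono fun t => ?_
  rw [mul_left_comm]
  gcongr
  set O := {ζ | ENNReal.ofReal t < essSup X (ν.restrict (lens ζ))} with hO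
  set S := {z | (z ∈ disc ∧ z ≠ 0) ∧ tent z ⊆ O} with hS
  have h3 := measure_biUnion_tent_le (l := l) (μ := μ) (ρ := μ) (S := S) (fun a ha => ha.1)
    (M := 21 * N * K) (c := 1) (fun b hb => hμ.box_le_of_tent_le hl hb.1.1 hb.1.2)
    (fun a _ => by rw [one_mul])
  -- Almost every point where X > t is the apex of a tent contained in the level set O, so the
  -- covering inequality compares the two distribution functions.
  have h4 : l {z | ENNReal.ofReal t < X z} ≤ l (⋃ a ∈ S, insert a (tent a)) := by
    refine measure_mono_ae ?_
    filter_upwards [hl0, hac.ae_le (ae_lt_essSup_lens ν X (ENNReal.ofReal t))] with z hz1 hz2 hz3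
    exact mem_iUnion₂.2 ⟨z, ⟨hz1, fun ζ hζ => hz2 hz3 ζ hζ.2⟩, mem_insert _ _⟩
  refine h4.trans (h3.trans ?_)
  rw [mul_one]
  gcongr
  exact iUnion₂_subset fun a ha => ha.2

/-! ### The product inequality -/

theorem lintegral_lens_swap {μ ν : Measure ℂ} [SFinite μ] [SFinite ν] (hμ : μ discᶜ = 0)
    {Φ Ψ : ℂ → ℝ≥0∞} (hΦ : Measurable Φ) (hΨ : Measurable Ψ) :
    ∫⁻ ζ, Φ ζ * ∫⁻ z in lens ζ, Ψ z ∂ν ∂μ = ∫⁻ z, Ψ z * ∫⁻ ζ in tent z, Φ ζ ∂μ ∂ν := by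
  have hm : Measurable ({x : ℂ × ℂ | x.1 ∈ tent x.2}.indicator fun x => Φ x.1 * Ψ x.2) :=
    ((hΦ.comp measurable_fst).mul (hΨ.comp measurable_snd)).indicator
      isOpen_tent_rel.measurableSet
  have e1 : ∫⁻ ζ, Φ ζ * ∫⁻ z in lens ζ, Ψ z ∂ν ∂μ = ∫⁻ ζ, ∫⁻ z,
      {x : ℂ × ℂ | x.1 ∈ tent x.2}.indicator (fun x => Φ x.1 * Ψ x.2) (ζ, z) ∂ν ∂μ := by
    refine lintegral_congr_ae ?_
    filter_upwards [measure_eq_zero_iff_ae_notMem.1 hμ] with ζ hζ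
    rw [← lintegral_indicator (isOpen_lens ζ).measurableSet,
      ← lintegral_const_mul _ (hΨ.indicator (isOpen_lens ζ).measurableSet)]
    refine lintegral_congr fun z => ?_
    by_cases h : z ∈ lens ζ
    · rw [indicator_of_mem h,
        indicator_of_mem (show (ζ, z) ∈ {x : ℂ × ℂ | x.1 ∈ tent x.2} from ⟨not_not.1 hζ, h⟩)]
    · rw [indicator_of_notMem h,
        indicator_of_notMem (show (ζ, z) ∉ {x : ℂ × ℂ | x.1 ∈ tent x.2} from fun h' => h h'.2),
        mul_zero]
  rw [e1, lintegral_lintegral_swap (f := fun ζ z =>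
    {x : ℂ × ℂ | x.1 ∈ tent x.2}.indicator (fun x => Φ x.1 * Ψ x.2) (ζ, z)) hm.aemeasurable]
  refine lintegral_congr fun z => ?_
  rw [← lintegral_indicator (isOpen_tent z).measurableSet,
      ← lintegral_const_mul _ (hΦ.indicator (isOpen_tent z).measurableSet)]
  refine lintegral_congr fun ζ => ?_
  by_cases h : ζ ∈ tent z
  · rw [indicator_of_mem h,
      indicator_of_mem (show (ζ, z) ∈ {x : ℂ × ℂ | x.1 ∈ tent x.2} from h), mul_comm]
  · rw [indicator_of_notMem h,
      indicator_of_notMem (show (ζ, z) ∉ {x : ℂ × ℂ | x.1 ∈ tent x.2} from h), mul_zero]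

/-- The Carleson condition on `H dν` relative to `μ`, with constant `N`. -/
def IsCarleson (μ ν : Measure ℂ) (H : ℂ → ℝ≥0∞) (N : ℝ≥0) : Prop :=
  ∀ a ∈ disc, a ≠ 0 → ∫⁻ z in tent a, H z * μ (tent z) ∂ν ≤ N * μ (tent a)

/-- Duality: pair A with A^(t-1), move to the Carleson measure H μ(T(z)) dν by Fubini, and apply the
embedding, Hölder, and the maximal theorem for the conjugate exponent. -/
theorem TentDoubling.exists_lintegral_rpow_le_of_one_lt {μ : Measure ℂ} {K : ℝ≥0}
    (hμ : TentDoubling μ K) {t : ℝ} (ht : 1 < t) :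
    ∃ C : ℝ≥0, ∀ ν : Measure ℂ, SigmaFinite ν → ∀ G H : ℂ → ℝ≥0∞, Measurable G → Measurable H →
      (∀ z, H z ≠ ∞) → ∀ N : ℝ≥0, IsCarleson μ ν H N →
      ∫⁻ ζ, (∫⁻ z in lens ζ, G z * H z ∂ν) ^ t ∂μ ≤
        C * N ^ t * ∫⁻ ζ, essSup G (ν.restrict (lens ζ)) ^ t ∂μ := by
  have := hμ.finite
  have hpq : t.HolderConjugate (t.conjExponent) := Real.HolderConjugate.conjExponent ht
  set t' := t.conjExponent with ht'
  obtain ⟨C₂, hC₂⟩ := hμ.exists_lintegral_lensSup_tentAvg_le hpq.symm.lt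
  refine ⟨(21 * K * C₂ ^ (1 / t')) ^ t, fun ν hν G H hG hH hHt N hN => ?_⟩
  have ht0 : 0 < t := by linarith
  have ht'0 : 0 < t' := hpq.symm.pos
  set A : ℂ → ℝ≥0∞ := fun ζ => ∫⁻ z in lens ζ, G z * H z ∂ν with hA
  have hAm : Measurable A := measurable_lintegral_lens ν (hG.mul hH)
  set J := ∫⁻ ζ, essSup G (ν.restrict (lens ζ)) ^ t ∂μ with hJ
  let l := ν.withDensity fun z => H z * μ (tent z)
  have hlm : Measurable fun z => H z * μ (tent z) := hH.mul (measurable_measure_tent μ)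
  have hlfin : ∀ z, H z * μ (tent z) ≠ ∞ := fun z => ENNReal.mul_ne_top (hHt z) (measure_ne_top _ _)
  have hlσ : SigmaFinite l := SigmaFinite.withDensity_of_ne_top (.of_forall hlfin)
  have hac : l ≪ ν := withDensity_absolutelyContinuous _ _
  have hl0 : ∀ᵐ z ∂l, z ∈ disc ∧ z ≠ 0 := by
    rw [ae_withDensity_iff hlm]
    refine .of_forall fun z hz => ?_
    by_contra hcon
    apply hz
    have : tent z = ∅ := by
      by_cases h1 : z ∈ disc
      · have : z = 0 := by by_contra h2; exact hcon ⟨h1, h2⟩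
        rw [this, tent_zero]
      · exact tent_eq_empty_of_notMem h1
    rw [this, measure_empty, mul_zero]
  have hl : ∀ a ∈ disc, a ≠ 0 → l (tent a) ≤ N * μ (tent a) := fun a ha ha0 => by
    rw [withDensity_apply _ (isOpen_tent a).measurableSet]; exact hN a ha ha0
  -- Truncation makes I finite, so that I^(1/t') can be cancelled from both sides; monotone
  -- convergence removes n at the end.
  have key : ∀ n : ℕ, ∫⁻ ζ, (min (A ζ) n) ^ t ∂μ ≤
      (((21 * K * C₂ ^ (1 / t')) ^ t : ℝ≥0) : ℝ≥0∞) * N ^ t * J := by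
    intro n
    set φ : ℂ → ℝ≥0∞ := fun ζ => (min (A ζ) n) ^ (t - 1) with hφ
    have hφm : Measurable φ := (hAm.min measurable_const).pow_const _
    set I := ∫⁻ ζ, (min (A ζ) n) ^ t ∂μ with hI
    have hIfin : I ≠ ∞ := by
      refine ne_top_of_le_ne_top (b := ∫⁻ ζ, (n : ℝ≥0∞) ^ t ∂μ) ?_
        (lintegral_mono fun ζ => ENNReal.rpow_le_rpow (min_le_right _ _) ht0.le)
      rw [lintegral_const]
      exact ENNReal.mul_ne_top (ENNReal.rpow_ne_top_of_nonneg ht0.le (ENNReal.natCast_ne_top n))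
        (measure_ne_top _ _)
    have s1 : I ≤ ∫⁻ ζ, φ ζ * A ζ ∂μ := by
      refine lintegral_mono fun ζ => ?_
      have e : (min (A ζ) n) ^ t = (min (A ζ) n) ^ (t - 1) * min (A ζ) n := by
        nth_rewrite 3 [← ENNReal.rpow_one (min (A ζ) n)]
        rw [← ENNReal.rpow_add_of_nonneg _ _ (by linarith) zero_le_one, sub_add_cancel]
      rw [e]
      exact mul_le_mul_right (min_le_left _ _) _
    have s2 : ∫⁻ ζ, φ ζ * A ζ ∂μ = ∫⁻ z, G z * tentAvg μ φ z ∂l := by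
      rw [lintegral_lens_swap (Ψ := fun z => G z * H z) hμ.compl_disc hφm (hG.mul hH),
        lintegral_withDensity_eq_lintegral_mul _ hlm
          (g := fun z => G z * tentAvg μ φ z) (hG.mul (measurable_tentAvg μ hφm))]
      refine lintegral_congr fun z => ?_
      have e : μ (tent z) * tentAvg μ φ z = ∫⁻ ζ in tent z, φ ζ ∂μ := by
        by_cases h0 : μ (tent z) = 0
        · rw [h0, zero_mul, setLIntegral_measure_zero _ _ h0]
        · exact ENNReal.mul_div_cancel h0 (measure_ne_top _ _)
      simp only [Pi.mul_apply]
      rw [← e]; ring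
    have s3 := hμ.lintegral_le_of_tent_le (ν := ν) hac hl0 hl (hG.mul (measurable_tentAvg μ hφm))
    have s4 : ∀ ζ, essSup (fun z => G z * tentAvg μ φ z) (ν.restrict (lens ζ)) ≤
        essSup G (ν.restrict (lens ζ)) * lensSup (tentAvg μ φ) ζ := by
      intro ζ
      refine essSup_le_of_ae_le _ ?_
      filter_upwards [ENNReal.ae_le_essSup G, ae_restrict_mem (isOpen_lens ζ).measurableSet]
        with z h1 h2
      gcongr
      exact le_iSup₂ (f := fun z (_ : z ∈ lens ζ) => tentAvg μ φ z) z h2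
    have s5 := ENNReal.lintegral_mul_le_Lp_mul_Lq μ hpq
      (f := fun ζ => essSup G (ν.restrict (lens ζ))) (g := lensSup (tentAvg μ φ))
      (measurable_essSup_lens ν hG).aemeasurable (measurable_lensSup _).aemeasurable
    have s6 : ∫⁻ ζ, lensSup (tentAvg μ φ) ζ ^ t' ∂μ ≤ C₂ * I := by
      refine (hC₂ φ hφm).trans (le_of_eq ?_)
      congr 1
      refine lintegral_congr fun ζ => ?_
      rw [hφ, ← ENNReal.rpow_mul, hpq.sub_one_mul_conj]
    have s7 : I ≤ (21 * N * K * C₂ ^ (1 / t') * J ^ (1 / t)) * I ^ (1 / t') := by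
      calc I ≤ 21 * N * K * ∫⁻ ζ, essSup (fun z => G z * tentAvg μ φ z) (ν.restrict (lens ζ)) ∂μ :=
            s1.trans (s2.le.trans s3)
        _ ≤ 21 * N * K * (J ^ (1 / t) * (C₂ * I) ^ (1 / t')) := by
            gcongr
            refine (lintegral_mono s4).trans (s5.trans ?_)
            gcongr
        _ = _ := by
            rw [ENNReal.mul_rpow_of_nonneg _ _ (by positivity)]; ring
    have s8 : I ^ (1 / t) ≤ 21 * N * K * C₂ ^ (1 / t') * J ^ (1 / t) := by
      by_cases hI0 : I = 0
      · rw [hI0, ENNReal.zero_rpow_of_pos (by positivity)]; exact zero_le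
      · have e : I = I ^ (1 / t) * I ^ (1 / t') := by
          rw [← ENNReal.rpow_add _ _ hI0 hIfin, one_div, one_div, hpq.inv_add_inv_eq_one,
            ENNReal.rpow_one]
        refine (ENNReal.mul_le_mul_iff_left ?_ ?_).1 (e.symm.le.trans s7)
        · exact (ENNReal.rpow_pos (pos_iff_ne_zero.2 hI0) hIfin).ne'
        · exact ENNReal.rpow_ne_top_of_nonneg (by positivity) hIfin
    have s9 := ENNReal.rpow_le_rpow s8 ht0.le
    rw [← ENNReal.rpow_mul, one_div_mul_cancel ht0.ne', ENNReal.rpow_one,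
      ENNReal.mul_rpow_of_nonneg _ _ ht0.le, ← ENNReal.rpow_mul, one_div_mul_cancel ht0.ne',
      ENNReal.rpow_one] at s9
    refine s9.trans (le_of_eq ?_)
    congr 1
    rw [ENNReal.coe_rpow_of_nonneg _ ht0.le, ← ENNReal.mul_rpow_of_nonneg _ _ ht0.le]
    congr 1
    push_cast
    rw [ENNReal.coe_rpow_of_nonneg _ (by positivity : 0 ≤ 1 / t')]
    ring
  have hlim : ∫⁻ ζ, A ζ ^ t ∂μ = ⨆ n : ℕ, ∫⁻ ζ, (min (A ζ) n) ^ t ∂μ := by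
    rw [← lintegral_iSup (fun n => (hAm.min measurable_const).pow_const t)
      (fun m n hmn ζ => by
        simp only
        gcongr)]
    refine lintegral_congr fun ζ => ?_
    refine le_antisymm ?_ (iSup_le fun n => ENNReal.rpow_le_rpow (min_le_left _ _) ht0.le)
    refine le_of_forall_lt fun c hc => ?_
    have h1 := (ENNReal.lt_rpow_inv_iff (inv_pos.2 ht0)).1 ((inv_inv t).symm ▸ hc)
    obtain ⟨n, hn⟩ := ENNReal.exists_nat_gt h1.ne_top
    refine lt_iSup_iff.2 ⟨n, ?_⟩
    have h2 := (ENNReal.lt_rpow_inv_iff (inv_pos.2 ht0)).2 (lt_min h1 hn)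
    rwa [inv_inv] at h2
  rw [hlim]
  exact iSup_le key

/-- With θ = s/(s+1), write G = G^(1-θ) G^θ and bound the first factor by its essential supremum
over the lens. The case t = s + 1 applied to G^θ costs the integral of the supremum to the power θt
= s, and Hölder with exponents s + 1 and 1/θ recombines. -/
theorem TentDoubling.exists_lintegral_rpow_le {μ : Measure ℂ} {K : ℝ≥0}
    (hμ : TentDoubling μ K) {s : ℝ} (hs : 0 < s) :
    ∃ C : ℝ≥0, ∀ ν : Measure ℂ, SigmaFinite ν → ∀ G H : ℂ → ℝ≥0∞, Measurable G → Measurable H →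
      (∀ z, H z ≠ ∞) → ∀ N : ℝ≥0, IsCarleson μ ν H N →
      ∫⁻ ζ, (∫⁻ z in lens ζ, G z * H z ∂ν) ^ s ∂μ ≤
        C * N ^ s * ∫⁻ ζ, essSup G (ν.restrict (lens ζ)) ^ s ∂μ := by
  obtain ⟨C, hC⟩ := hμ.exists_lintegral_rpow_le_of_one_lt (t := s + 1) (by linarith)
  set θ := s / (s + 1) with hθ
  have hs1 : 0 < s + 1 := by linarith
  have hθ0 : 0 < θ := by positivity
  have hθ1 : 1 - θ = 1 / (s + 1) := by rw [hθ]; field_simp; ring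
  have hθs : s / θ = s + 1 := by rw [hθ]; field_simp
  have hpq : (s + 1).HolderConjugate (1 / θ) := by
    rw [Real.holderConjugate_iff]
    refine ⟨by linarith, ?_⟩
    rw [hθ]; field_simp; ring
  refine ⟨C ^ θ, fun ν hν G H hG hH hHt N hN => ?_⟩
  set Gs : ℂ → ℝ≥0∞ := fun ζ => essSup G (ν.restrict (lens ζ)) with hGs
  have hGsm : Measurable Gs := measurable_essSup_lens ν hG
  set B : ℂ → ℝ≥0∞ := fun ζ => ∫⁻ z in lens ζ, G z ^ θ * H z ∂ν with hB
  have hBm : Measurable B := measurable_lintegral_lens ν ((hG.pow_const θ).mul hH)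
  set J := ∫⁻ ζ, Gs ζ ^ s ∂μ with hJ
  have h1 : ∀ ζ, ∫⁻ z in lens ζ, G z * H z ∂ν ≤ Gs ζ ^ (1 / (s + 1)) * B ζ := by
    intro ζ
    rw [← lintegral_const_mul (f := fun z => G z ^ θ * H z) _ ((hG.pow_const θ).mul hH)]
    refine lintegral_mono_ae ?_
    filter_upwards [ENNReal.ae_le_essSup (μ := ν.restrict (lens ζ)) G] with z hz
    calc G z * H z = G z ^ (1 / (s + 1)) * (G z ^ θ * H z) := by
          rw [← mul_assoc, ← ENNReal.rpow_add_of_nonneg _ _ (by positivity) hθ0.le, ← hθ1,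
            sub_add_cancel, ENNReal.rpow_one]
      _ ≤ _ := by
          gcongr
  have h2 : ∫⁻ ζ, B ζ ^ (s + 1) ∂μ ≤ C * N ^ (s + 1) * J := by
    refine (hC ν hν _ H (hG.pow_const θ) hH hHt N hN).trans ?_
    gcongr
    refine lintegral_mono fun ζ => ?_
    have h3 : essSup (fun z => G z ^ θ) (ν.restrict (lens ζ)) ≤ Gs ζ ^ θ := by
      refine essSup_le_of_ae_le _ ?_
      filter_upwards [ENNReal.ae_le_essSup (μ := ν.restrict (lens ζ)) G] with z hz
      gcongr
    refine (ENNReal.rpow_le_rpow h3 hs1.le).trans (le_of_eq ?_)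
    rw [← ENNReal.rpow_mul, hθ, div_mul_cancel₀ _ hs1.ne']
  have h4 := ENNReal.lintegral_mul_le_Lp_mul_Lq μ hpq
    (f := fun ζ => Gs ζ ^ (s / (s + 1))) (g := fun ζ => B ζ ^ s)
    (hGsm.pow_const _).aemeasurable (hBm.pow_const _).aemeasurable
  have e1 : ∫⁻ ζ, (Gs ζ ^ (s / (s + 1))) ^ (s + 1) ∂μ = J := by
    refine lintegral_congr fun ζ => ?_
    rw [← ENNReal.rpow_mul, div_mul_cancel₀ _ hs1.ne']
  have e2 : ∫⁻ ζ, (B ζ ^ s) ^ (1 / θ) ∂μ = ∫⁻ ζ, B ζ ^ (s + 1) ∂μ := by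
    refine lintegral_congr fun ζ => ?_
    rw [← ENNReal.rpow_mul, mul_one_div, hθs]
  rw [e1, e2, one_div_one_div] at h4
  calc _ ≤ ∫⁻ ζ, Gs ζ ^ (s / (s + 1)) * B ζ ^ s ∂μ := by
        refine lintegral_mono fun ζ => ?_
        refine (ENNReal.rpow_le_rpow (h1 ζ) hs.le).trans (le_of_eq ?_)
        rw [ENNReal.mul_rpow_of_nonneg _ _ hs.le, ← ENNReal.rpow_mul, one_div_mul_eq_div]
    _ ≤ J ^ (1 / (s + 1)) * (C * N ^ (s + 1) * J) ^ θ := by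
        refine h4.trans ?_
        gcongr
    _ = _ := by
        rw [ENNReal.mul_rpow_of_nonneg _ _ hθ0.le, ENNReal.mul_rpow_of_nonneg _ _ hθ0.le,
          ← ENNReal.rpow_mul, hθ, mul_div_cancel₀ _ hs1.ne', ← hθ, mul_left_comm,
          ← ENNReal.rpow_add_of_nonneg _ _ (by positivity) hθ0.le, ← hθ1, sub_add_cancel,
          ENNReal.rpow_one, ENNReal.coe_rpow_of_nonneg _ hθ0.le]

/-! ### From tent space norms to the Carleson condition -/

theorem area_tent_ne_zero {a : ℂ} (ha : a ∈ disc) (h0 : a ≠ 0) : area (tent a) ≠ 0 := by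
  rw [area, Measure.smul_apply, Measure.restrict_apply (isOpen_tent a).measurableSet,
    inter_eq_left.2 (tent_subset_disc a), smul_eq_mul]
  exact mul_ne_zero (ENNReal.inv_ne_zero.2 ENNReal.ofReal_ne_top)
    ((isOpen_tent a).measure_pos _ (tent_nonempty ha h0)).ne'

theorem mem_tentPQ {p q : ℝ} {ν : Measure ℂ} {ω : ℂ → ℝ≥0} {f : ℂ →ₘ[ν] ℂ} :
    f ∈ TentPQ p q ν ω ↔ normPQ p q ν ω f < ∞ := Iff.rfl

theorem mem_tentPInf {p : ℝ} {ν : Measure ℂ} {ω : ℂ → ℝ≥0} {f : ℂ →ₘ[ν] ℂ} :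
    f ∈ TentPInf p ν ω ↔ normPInf p ν ω f < ∞ := Iff.rfl

theorem mem_tentInfQ {q : ℝ} {ν : Measure ℂ} {ω : ℂ → ℝ≥0} {f : ℂ →ₘ[ν] ℂ} :
    f ∈ TentInfQ q ν ω ↔ normInfQ q ν ω f < ∞ := Iff.rfl

theorem areaFn_congr {q : ℝ} {ν : Measure ℂ} {f g : ℂ → ℂ} (h : f =ᵐ[ν] g) :
    areaFn q ν f = areaFn q ν g := by
  ext ζ
  unfold areaFn
  congr 1
  refine lintegral_congr_ae (ae_restrict_of_ae ?_)
  filter_upwards [h] with z hz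
  rw [hz]

theorem normPQ_congr {p q : ℝ} {ν : Measure ℂ} {ω : ℂ → ℝ≥0} {f g : ℂ → ℂ} (h : f =ᵐ[ν] g) :
    normPQ p q ν ω f = normPQ p q ν ω g := by
  rw [normPQ, areaFn_congr h, normPQ]

theorem normPInf_congr {p : ℝ} {ν : Measure ℂ} {ω : ℂ → ℝ≥0} {f g : ℂ → ℂ} (h : f =ᵐ[ν] g) :
    normPInf p ν ω f = normPInf p ν ω g := by
  have : maxFn ν f = maxFn ν g := by
    ext ζ
    refine essSup_congr_ae (ae_restrict_of_ae ?_)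
    filter_upwards [h] with z hz
    rw [hz]
  rw [normPInf, this, normPInf]

theorem normInfQ_congr {q : ℝ} {ν : Measure ℂ} {ω : ℂ → ℝ≥0} {f g : ℂ → ℂ} (h : f =ᵐ[ν] g) :
    normInfQ q ν ω f = normInfQ q ν ω g := by
  have : carlesonFn q ν ω f = carlesonFn q ν ω g := by
    ext ζ
    have h1 : ∀ a, ∫⁻ z in tent a, ‖f z‖ₑ ^ q * weightMeasure ω (tent z) ∂ν =
        ∫⁻ z in tent a, ‖g z‖ₑ ^ q * weightMeasure ω (tent z) ∂ν := fun a => by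
      refine lintegral_congr_ae (ae_restrict_of_ae ?_)
      filter_upwards [h] with z hz
      rw [hz]
    unfold carlesonFn
    simp_rw [h1]
  rw [normInfQ, this, normInfQ]

theorem areaFn_rpow {p q : ℝ} (ν : Measure ℂ) (f : ℂ → ℂ) (ζ : ℂ) :
    areaFn q ν f ζ ^ p = (∫⁻ z in lens ζ, ‖f z‖ₑ ^ q ∂ν) ^ (p / q) := by
  rw [areaFn, ← ENNReal.rpow_mul, one_div_mul_eq_div]

/-- T(a) has positive area, so it contains a ζ at which the almost-everywhere bound on `carlesonFn`
holds; a lies in Γ(ζ) and is thus a competitor in the supremum. -/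
theorem isCarleson_of_normInfQ_lt_top {q : ℝ} (hq : 0 < q) {ω : ℂ → ℝ≥0} {K : ℝ≥0}
    (hμ : TentDoubling (weightMeasure ω) K) {ν : Measure ℂ} {h : ℂ → ℂ}
    (hh : normInfQ q ν ω h < ∞) :
    IsCarleson (weightMeasure ω) ν (fun z => ‖h z‖ₑ ^ q) ((normInfQ q ν ω h).toNNReal ^ q) := by
  have := hμ.finite
  intro a ha ha0
  rw [ENNReal.coe_rpow_of_nonneg _ hq.le, ENNReal.coe_toNNReal hh.ne]
  have h1 : ∃ᵐ ζ ∂area, ζ ∈ tent a := frequently_ae_mem_iff.2 (area_tent_ne_zero ha ha0)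
  obtain ⟨ζ, h2, h3⟩ := (h1.and_eventually
    (ENNReal.ae_le_essSup (μ := area) (carlesonFn q ν ω h))).exists
  change _ ≤ normInfQ q ν ω h at h3
  rw [carlesonFn, one_div, ENNReal.rpow_inv_le_iff hq] at h3
  have h4 := (le_iSup₂ (f := fun a (_ : a ∈ lens ζ) => (∫⁻ z in tent a, ‖h z‖ₑ ^ q *
    weightMeasure ω (tent z) ∂ν) / weightMeasure ω (tent a)) a h2.2).trans h3
  rwa [ENNReal.div_le_iff (hμ.pos a ha ha0) (measure_ne_top _ _)] at h4

theorem exists_normPQ_mul_le {p q : ℝ} (hp : 0 < p) (hq : 0 < q) {ω : ℂ → ℝ≥0} {K : ℝ≥0}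
    (hμ : TentDoubling (weightMeasure ω) K) :
    ∃ C : ℝ≥0, ∀ ν : Measure ℂ, IsDiscMeasure ν → ∀ g h : ℂ → ℂ, Measurable g → Measurable h →
      normInfQ q ν ω h < ∞ → normPQ p q ν ω (g * h) ≤ C * normPInf p ν ω g * normInfQ q ν ω h := by
  obtain ⟨C, hC⟩ := hμ.exists_lintegral_rpow_le (div_pos hp hq)
  refine ⟨C ^ (1 / p), fun ν hν g h hg hh hN => ?_⟩
  have h1 := hC ν hν.sigmaFinite (fun z => ‖g z‖ₑ ^ q) (fun z => ‖h z‖ₑ ^ q)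
    (hg.enorm.pow_const q) (hh.enorm.pow_const q)
    (fun z => ENNReal.rpow_ne_top_of_nonneg hq.le enorm_ne_top) _
    (isCarleson_of_normInfQ_lt_top hq hμ hN)
  set N := normInfQ q ν ω h with hNdef
  have e1 : (((N.toNNReal ^ q : ℝ≥0) : ℝ≥0∞)) ^ (p / q) = N ^ p := by
    rw [ENNReal.coe_rpow_of_nonneg _ hq.le, ENNReal.coe_toNNReal hN.ne, ← ENNReal.rpow_mul,
      mul_div_cancel₀ _ hq.ne']
  have e2 : ∫⁻ ζ, essSup (fun z => ‖g z‖ₑ ^ q) (ν.restrict (lens ζ)) ^ (p / q) ∂weightMeasure ω ≤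
      ∫⁻ ζ, maxFn ν g ζ ^ p ∂weightMeasure ω := by
    refine lintegral_mono fun ζ => ?_
    have h2 : essSup (fun z => ‖g z‖ₑ ^ q) (ν.restrict (lens ζ)) ≤ maxFn ν g ζ ^ q := by
      refine essSup_le_of_ae_le _ ?_
      filter_upwards [ENNReal.ae_le_essSup (μ := ν.restrict (lens ζ)) fun z => ‖g z‖ₑ] with z hz
      exact ENNReal.rpow_le_rpow hz hq.le
    refine (ENNReal.rpow_le_rpow h2 (by positivity)).trans (le_of_eq ?_)
    rw [← ENNReal.rpow_mul, mul_div_cancel₀ _ hq.ne']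
  have e3 : ∫⁻ ζ, areaFn q ν (g * h) ζ ^ p ∂weightMeasure ω ≤
      C * N ^ p * ∫⁻ ζ, maxFn ν g ζ ^ p ∂weightMeasure ω := by
    simp_rw [areaFn_rpow]
    rw [e1] at h1
    refine le_trans (le_of_eq ?_) (h1.trans (by gcongr))
    refine lintegral_congr fun ζ => ?_
    congr 1
    refine lintegral_congr fun z => ?_
    rw [Pi.mul_apply, enorm_mul, ENNReal.mul_rpow_of_nonneg _ _ hq.le]
  have hp' : 0 ≤ 1 / p := by positivity
  have e4 := ENNReal.rpow_le_rpow e3 hp'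
  rw [ENNReal.mul_rpow_of_nonneg _ _ hp', ENNReal.mul_rpow_of_nonneg _ _ hp', ← ENNReal.rpow_mul,
    mul_one_div_cancel hp.ne', ENNReal.rpow_one, ← ENNReal.coe_rpow_of_nonneg _ hp'] at e4
  refine e4.trans (le_of_eq ?_)
  rw [normPInf, lpNorm]; ring

/-! ### The factorization -/

/-- The harmonic mean over the tent at a point. -/
noncomputable def harmonicMean (μ : Measure ℂ) (A : ℂ → ℝ≥0∞) (z : ℂ) : ℝ≥0∞ :=
  μ (tent z) / ∫⁻ ζ in tent z, (A ζ)⁻¹ ∂μ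

theorem measurable_harmonicMean (μ : Measure ℂ) [SFinite μ] {A : ℂ → ℝ≥0∞} (hA : Measurable A) :
    Measurable (harmonicMean μ A) :=
  (measurable_measure_tent μ).div (measurable_lintegral_tent μ hA.inv)

/-- Chebyshev: the mean of 1/A is at most 1/t, whereas 1/A ≥ 2/t off E, so at most half of the tent
lies off E. -/
theorem measure_tent_le_of_lt_harmonicMean {μ : Measure ℂ} [IsFiniteMeasure μ] {A : ℂ → ℝ≥0∞}
    (hA : Measurable A) {z : ℂ} {t : ℝ} (ht : 0 < t) (h : ENNReal.ofReal t < harmonicMean μ A z) :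
    μ (tent z) ≤ 2 * μ (tent z ∩ {ζ | ENNReal.ofReal t < 2 * A ζ}) := by
  set E := {ζ | ENNReal.ofReal t < 2 * A ζ} with hE
  have hm : MeasurableSet E := measurableSet_lt measurable_const (hA.const_mul 2)
  have htm := (isOpen_tent z).measurableSet
  have h1 := ENNReal.mul_le_of_le_div h.le
  have h2 : 2 * μ (tent z \ E) ≤ ENNReal.ofReal t * ∫⁻ ζ in tent z, (A ζ)⁻¹ ∂μ := by
    rw [← lintegral_const_mul (f := fun ζ => (A ζ)⁻¹) _ hA.inv, ← setLIntegral_const]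
    refine le_trans ?_ (lintegral_mono_set (sdiff_subset (s := tent z) (t := E)))
    refine setLIntegral_mono' (htm.diff hm) fun ζ hζ => ?_
    have h3 : 2 * A ζ ≤ ENNReal.ofReal t := not_lt.1 hζ.2
    rw [← div_eq_mul_inv]
    exact (ENNReal.le_div_iff_mul_le (Or.inr (ENNReal.ofReal_pos.2 ht).ne')
      (Or.inr ENNReal.ofReal_ne_top)).2 h3
  have h4 := h2.trans h1
  rw [← measure_inter_add_sdiff (tent z) hm, two_mul] at h4
  have h5 := ENNReal.le_of_add_le_add_right (measure_ne_top μ _) h4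
  rw [← measure_inter_add_sdiff (tent z) hm, two_mul]
  gcongr

/-- After Fubini, the inner integral of F over Γ(ζ) ∩ T(a) is at most the integral that is being
inverted, and it vanishes unless ζ lies in a tent with apex in T(a), hence in the box about a. -/
theorem TentDoubling.setLIntegral_tent_le {μ ν : Measure ℂ} {K : ℝ≥0} (hμ : TentDoubling μ K)
    [SFinite ν] {F : ℂ → ℝ≥0∞} (hF : Measurable F) {a : ℂ} (ha : a ∈ disc) (h0 : a ≠ 0) :
    ∫⁻ z in tent a, F z * ∫⁻ ζ in tent z, (∫⁻ w in lens ζ, F w ∂ν)⁻¹ ∂μ ∂ν ≤ K * μ (tent a) := by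
  have := hμ.finite
  have hta := (isOpen_tent a).measurableSet
  set A : ℂ → ℝ≥0∞ := fun ζ => ∫⁻ w in lens ζ, F w ∂ν with hA
  have hAm : Measurable A := measurable_lintegral_lens ν hF
  have h1 := lintegral_lens_swap (ν := ν) hμ.compl_disc hAm.inv (hF.indicator hta)
  have e1 : ∫⁻ z in tent a, F z * ∫⁻ ζ in tent z, (A ζ)⁻¹ ∂μ ∂ν =
      ∫⁻ z, (tent a).indicator F z * ∫⁻ ζ in tent z, (A ζ)⁻¹ ∂μ ∂ν := by
    rw [← lintegral_indicator hta]
    refine lintegral_congr fun z => ?_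
    by_cases hz : z ∈ tent a
    · rw [indicator_of_mem hz, indicator_of_mem hz]
    · rw [indicator_of_notMem hz, indicator_of_notMem hz, zero_mul]
  have hbox : MeasurableSet (⋃ z ∈ tent a, tent z) :=
    (isOpen_biUnion fun z _ => isOpen_tent z).measurableSet
  calc _ = ∫⁻ ζ, (A ζ)⁻¹ * ∫⁻ z in lens ζ, (tent a).indicator F z ∂ν ∂μ := by
        rw [e1]; exact h1.symm
    _ ≤ ∫⁻ ζ, (⋃ z ∈ tent a, tent z).indicator 1 ζ ∂μ := by
        refine lintegral_mono_ae ?_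
        filter_upwards [measure_eq_zero_iff_ae_notMem.1 hμ.compl_disc] with ζ hζ
        by_cases h : ζ ∈ ⋃ z ∈ tent a, tent z
        · rw [indicator_of_mem h]
          have : ∫⁻ z in lens ζ, (tent a).indicator F z ∂ν ≤ A ζ :=
            lintegral_mono (indicator_le_self _ _)
          refine (mul_le_mul_right this _).trans ?_
          exact ENNReal.inv_mul_le_one (A ζ)
        · have : ∫⁻ z in lens ζ, (tent a).indicator F z ∂ν = 0 := by
            rw [setLIntegral_congr_fun (g := fun _ => 0) (isOpen_lens ζ).measurableSet]
            · simp
            · intro z hz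
              refine indicator_of_notMem (fun hza => h ?_) _
              exact mem_iUnion₂.2 ⟨z, hza, not_not.1 hζ, hz⟩
          rw [this, mul_zero]; exact zero_le
    _ = μ (⋃ z ∈ tent a, tent z) := lintegral_indicator_one hbox
    _ ≤ μ (box a) := measure_mono (iUnion₂_subset fun z hz => tent_subset_box_of_mem hz)
    _ ≤ _ := hμ.box_le a ha h0

theorem exists_mem_tent {z : ℂ} (hz : z ∈ disc) (h0 : z ≠ 0) :
    ∃ a ∈ disc, a ≠ 0 ∧ z ∈ tent a := by
  have h1 : 0 < ‖z‖ := norm_pos_iff.2 h0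
  have hz1 := mem_disc.1 hz
  have hm : z ∈ tent ((1 / 2 : ℝ) • z) := by
    refine mem_tent.2 ⟨hz1, h0, smul_ne_zero (by norm_num) h0, ?_⟩
    rw [angle_smul_left_of_pos _ _ (by norm_num), angle_self h0, norm_smul, mul_div_assoc,
      div_self h1.ne']
    norm_num
  exact ⟨_, mem_disc_of_mem_tent hm, ne_zero_of_mem_tent hm, hm⟩

/-- A property that holds almost everywhere on each tent holds almost everywhere in the punctured
disc. -/
theorem ae_of_ae_tent {ν : Measure ℂ} {P : ℂ → Prop}
    (h : ∀ a ∈ disc, a ≠ 0 → ∀ᵐ z ∂(ν.restrict (tent a)), P z) :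
    ∀ᵐ z ∂ν, z ∈ disc → z ≠ 0 → P z := by
  obtain ⟨v, hvs, hvc, hv⟩ := TopologicalSpace.isOpen_biUnion_countable
    {a | a ∈ disc ∧ a ≠ 0} tent fun a _ => isOpen_tent a
  have h1 : ∀ᵐ z ∂ν, ∀ a ∈ v, z ∈ tent a → P z := by
    rw [ae_ball_iff hvc]
    intro a ha
    exact (ae_restrict_iff' (isOpen_tent a).measurableSet).1 (h a (hvs ha).1 (hvs ha).2)
  filter_upwards [h1] with z hz hzd hz0
  obtain ⟨a, ha, ha0, hza⟩ := exists_mem_tent hzd hz0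
  have h2 : z ∈ ⋃ a ∈ {a | a ∈ disc ∧ a ≠ 0}, tent a := mem_iUnion₂.2 ⟨a, ⟨ha, ha0⟩, hza⟩
  rw [← hv] at h2
  obtain ⟨b, hb, hzb⟩ := mem_iUnion₂.1 h2
  exact hz b hb hzb

theorem exists_factorization {p q : ℝ} (hp : 0 < p) (hq : 0 < q) {ω : ℂ → ℝ≥0} {K : ℝ≥0}
    (hμ : TentDoubling (weightMeasure ω) K) {ν : Measure ℂ} (hν : IsDiscMeasure ν) {f : ℂ → ℂ}
    (hf : Measurable f) (hfin : normPQ p q ν ω f < ∞) :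
    ∃ g h : ℂ → ℂ, Measurable g ∧ Measurable h ∧ f =ᵐ[ν] g * h ∧
      normPInf p ν ω g ≤ (K * 2 * 2 ^ (p / q)) ^ (1 / p) * normPQ p q ν ω f ∧
      normInfQ q ν ω h ≤ K ^ (1 / q) := by
  set μ := weightMeasure ω with hμdef
  have := hμ.finite
  have := hν.sigmaFinite
  have hpq : 0 < p / q := div_pos hp hq
  set F : ℂ → ℝ≥0∞ := fun z => ‖f z‖ₑ ^ q with hF
  have hFm : Measurable F := hf.enorm.pow_const q
  set A : ℂ → ℝ≥0∞ := fun ζ => ∫⁻ z in lens ζ, F z ∂ν with hA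
  have hAm : Measurable A := measurable_lintegral_lens ν hFm
  have hnorm : normPQ p q ν ω f = (∫⁻ ζ, A ζ ^ (p / q) ∂μ) ^ (1 / p) := by
    unfold normPQ lpNorm
    simp_rw [areaFn_rpow]
    rfl
  have hAfin : ∀ᵐ ζ ∂μ, A ζ < ∞ := by
    have h1 : ∫⁻ ζ, A ζ ^ (p / q) ∂μ ≠ ∞ := by
      intro h
      rw [hnorm, h, ENNReal.top_rpow_of_pos (by positivity)] at hfin
      exact lt_irrefl _ hfin
    filter_upwards [ae_lt_top (hAm.pow_const _) h1] with ζ hζ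
    exact (ENNReal.rpow_lt_top_iff_of_pos hpq).1 hζ
  set D : ℂ → ℝ≥0∞ := fun z => ∫⁻ ζ in tent z, (A ζ)⁻¹ ∂μ with hD
  have hDm : Measurable D := measurable_lintegral_tent μ hAm.inv
  have hD0 : ∀ z ∈ disc, z ≠ 0 → D z ≠ 0 := by
    intro z hz hz0 h
    apply hμ.pos z hz hz0
    have h := (lintegral_eq_zero_iff (f := fun ζ => (A ζ)⁻¹) hAm.inv).1 h
    have h1 := h.and (ae_restrict_of_ae (s := tent z) hAfin)
    have h2 : ∀ᵐ ζ ∂(μ.restrict (tent z)), False := by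
      filter_upwards [h1] with ζ hζ
      exact hζ.2.ne (ENNReal.inv_eq_zero.1 hζ.1)
    rw [← Measure.restrict_eq_zero]
    exact ae_eq_bot.1 (Filter.eventually_false_iff_eq_bot.1 h2)
  set G := harmonicMean μ A with hG
  have hGm : Measurable G := measurable_harmonicMean μ hAm
  -- The origin lies in no lens, so g(0) does not affect the norms; a nonzero value keeps f = g ·
  -- (f/g) valid if ν has an atom there.
  let g : ℂ → ℂ := fun z => if z = 0 then 1 else ((G z ^ (1 / q)).toReal : ℂ)
  have hgm : Measurable g := Measurable.ite (measurableSet_singleton 0) measurable_const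
    (Complex.measurable_ofReal.comp (hGm.pow_const _).ennreal_toReal)
  -- Finiteness on tents forces D finite wherever f ≠ 0, so g does not vanish there. Where f = 0, a
  -- zero of g is harmless since 0/0 = 0.
  have hFD : ∀ᵐ z ∂ν, z ∈ disc → z ≠ 0 → F z * D z < ∞ := by
    refine ae_of_ae_tent fun a ha ha0 => ae_lt_top (hFm.mul hDm) ?_
    exact ne_top_of_le_ne_top (ENNReal.mul_ne_top ENNReal.coe_ne_top (measure_ne_top _ _))
      (hμ.setLIntegral_tent_le hFm ha ha0)
  have hdisc : ∀ᵐ z ∂ν, z ∈ disc := by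
    filter_upwards [measure_eq_zero_iff_ae_notMem.1 hν.compl_disc] with z hz using not_not.1 hz
  have hgood : ∀ z ∈ disc, z ≠ 0 → F z * D z < ∞ → f z ≠ 0 →
      G z * D z = μ (tent z) ∧ g z ≠ 0 ∧ ‖g z‖ₑ ^ q = G z := by
    intro z hz hz0 hzF hfz
    have hFz : F z ≠ 0 := (ENNReal.rpow_pos (enorm_pos.2 hfz) enorm_ne_top).ne'
    have hDt : D z ≠ ∞ := by
      intro h
      rw [h, ENNReal.mul_top hFz] at hzF
      exact lt_irrefl _ hzF
    have hG0 : G z ≠ 0 := (ENNReal.div_pos (hμ.pos z hz hz0) hDt).ne'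
    have hGt : G z ≠ ∞ := (ENNReal.div_lt_top (measure_ne_top _ _) (hD0 z hz hz0)).ne
    have hgz : ‖g z‖ₑ = G z ^ (1 / q) := by
      simp only [g, if_neg hz0]
      rw [← ofReal_norm, Complex.norm_real, Real.norm_of_nonneg ENNReal.toReal_nonneg,
        ENNReal.ofReal_toReal (ENNReal.rpow_ne_top_of_nonneg (by positivity) hGt)]
    refine ⟨ENNReal.div_mul_cancel (hD0 z hz hz0) hDt, ?_, ?_⟩
    · rw [← enorm_pos, hgz]
      exact ENNReal.rpow_pos (pos_iff_ne_zero.2 hG0) hGt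
    · rw [hgz, ← ENNReal.rpow_mul, one_div_mul_cancel hq.ne', ENNReal.rpow_one]
  refine ⟨g, fun z => f z / g z, hgm, hf.div hgm, ?_, ?_, ?_⟩
  · filter_upwards [hFD, hdisc] with z hz hzd
    rw [Pi.mul_apply]
    by_cases hz0 : z = 0
    · simp [g, hz0]
    by_cases hfz : f z = 0
    · simp [hfz]
    · rw [mul_div_cancel₀ _ (hgood z hzd hz0 (hz hzd hz0) hfz).2.1]
  · have h1 := hμ.lintegral_lensSup_rpow_le (X := G) hAm
      (fun z _ _ t ht h => measure_tent_le_of_lt_harmonicMean hAm ht h) hpq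
    have h2 : ∫⁻ ζ, maxFn ν g ζ ^ p ∂μ ≤ ∫⁻ ζ, lensSup G ζ ^ (p / q) ∂μ := by
      refine lintegral_mono fun ζ => ?_
      have h3 : maxFn ν g ζ ≤ lensSup G ζ ^ (1 / q) := by
        refine essSup_le_of_ae_le _ ?_
        filter_upwards [ae_restrict_mem (isOpen_lens ζ).measurableSet] with z hz
        have hgz : ‖g z‖ₑ ≤ G z ^ (1 / q) := by
          simp only [g, if_neg hz.2.1]
          rw [← ofReal_norm, Complex.norm_real, Real.norm_of_nonneg ENNReal.toReal_nonneg]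
          exact ENNReal.ofReal_toReal_le
        refine hgz.trans (ENNReal.rpow_le_rpow ?_ (by positivity))
        exact le_iSup₂ (f := fun z (_ : z ∈ lens ζ) => G z) z hz
      refine (ENNReal.rpow_le_rpow h3 hp.le).trans (le_of_eq ?_)
      rw [← ENNReal.rpow_mul, one_div_mul_eq_div]
    rw [hnorm, ← ENNReal.mul_rpow_of_nonneg _ _ (by positivity)]
    exact ENNReal.rpow_le_rpow (h2.trans h1) (by positivity)
  · refine essSup_le_of_ae_le _ (.of_forall fun ζ => ?_)
    refine ENNReal.rpow_le_rpow (iSup₂_le fun a ha => ENNReal.div_le_of_le_mul ?_) (by positivity)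
    by_cases had : a ∈ disc
    · refine le_trans ?_ (hμ.setLIntegral_tent_le (ν := ν) hFm had ha.2.1)
      refine lintegral_mono_ae ?_
      filter_upwards [ae_restrict_of_ae hFD, ae_restrict_mem (isOpen_tent a).measurableSet]
        with z hz hza
      have hzd := tent_subset_disc a hza
      have hz0 : z ≠ 0 := (mem_tent.1 hza).2.1
      by_cases hfz : f z = 0
      · rw [hfz, zero_div, enorm_zero, ENNReal.zero_rpow_of_pos hq, zero_mul]; exact zero_le
      · obtain ⟨h1, h2, h3⟩ := hgood z hzd hz0 (hz hzd hz0) hfz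
        have e : ‖f z / g z‖ₑ ^ q * G z = F z := by
          rw [← h3, ← ENNReal.mul_rpow_of_nonneg _ _ hq.le, ← enorm_mul, div_mul_cancel₀ _ h2]
        change ‖f z / g z‖ₑ ^ q * μ (tent z) ≤ F z * D z
        rw [← h1, ← mul_assoc, e]
    · rw [tent_eq_empty_of_notMem had]; simp

end WeightedTent

/-! ### Assembly of the two halves -/

theorem mainTheorem4 (p q : ℝ) (hp : 0 < p) (hq : 0 < q) (ω : ℂ → ℝ≥0)
    (hω : WeightedTent.IsDoublingWeight ω) :
    ∃ C : ℝ≥0, 0 < C ∧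
      ∀ ν : Measure ℂ, WeightedTent.IsDiscMeasure ν →
        (∀ g ∈ WeightedTent.TentPInf p ν ω, ∀ h ∈ WeightedTent.TentInfQ q ν ω,
          g * h ∈ WeightedTent.TentPQ p q ν ω ∧
          WeightedTent.normPQ p q ν ω (g * h : ℂ →ₘ[ν] ℂ) ≤
            C * WeightedTent.normPInf p ν ω g * WeightedTent.normInfQ q ν ω h) ∧
        (∀ f ∈ WeightedTent.TentPQ p q ν ω,
          ∃ g ∈ WeightedTent.TentPInf p ν ω, ∃ h ∈ WeightedTent.TentInfQ q ν ω,
            f = g * h ∧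
            WeightedTent.normPInf p ν ω g ≤ C * WeightedTent.normPQ p q ν ω f ∧
            WeightedTent.normPQ p q ν ω f ≤ C * WeightedTent.normPInf p ν ω g ∧
            WeightedTent.normInfQ q ν ω h ≤ C) := by
  by_cases h0 : WeightedTent.weightMeasure ω = 0
  · have hlp : ∀ F : ℂ → ℝ≥0∞, WeightedTent.lpNorm p ω F = 0 := fun F => by
      rw [WeightedTent.lpNorm, h0, lintegral_zero_measure, ENNReal.zero_rpow_of_pos (by positivity)]
    have hPQ : ∀ (ν : Measure ℂ) (f : ℂ → ℂ), WeightedTent.normPQ p q ν ω f = 0 := fun ν f => hlp _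
    have hPI : ∀ (ν : Measure ℂ) (f : ℂ → ℂ), WeightedTent.normPInf p ν ω f = 0 := fun ν f => hlp _
    have hIQ : ∀ (ν : Measure ℂ) (f : ℂ → ℂ), WeightedTent.normInfQ q ν ω f = 0 := fun ν f => by
      have : WeightedTent.carlesonFn q ν ω f = fun _ => 0 := by
        ext ζ
        simp [WeightedTent.carlesonFn, h0, hq]
      rw [WeightedTent.normInfQ, this]
      exact le_antisymm (essSup_le_of_ae_le _ (.of_forall fun _ => le_rfl)) zero_le
    refine ⟨1, one_pos, fun ν _ => ⟨fun g _ h _ => ⟨?_, ?_⟩, fun f _ => ⟨f, ?_, 1, ?_, ?_⟩⟩⟩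
    · rw [WeightedTent.mem_tentPQ, hPQ]; exact ENNReal.zero_lt_top
    · rw [hPQ]; exact zero_le
    · rw [WeightedTent.mem_tentPInf, hPI]; exact ENNReal.zero_lt_top
    · rw [WeightedTent.mem_tentInfQ, hIQ]; exact ENNReal.zero_lt_top
    · rw [hPI, hPQ, hIQ]; simp
  obtain ⟨K, hK⟩ := hω.exists_tentDoubling h0
  obtain ⟨C₁, hC₁⟩ := WeightedTent.exists_normPQ_mul_le hp hq hK
  set C₂ : ℝ≥0 := (K * 2 * 2 ^ (p / q)) ^ (1 / p) with hC₂
  set C₃ : ℝ≥0 := K ^ (1 / q) with hC₃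
  have hc₂ : ((K : ℝ≥0∞) * 2 * 2 ^ (p / q)) ^ (1 / p) = C₂ := by
    rw [hC₂, ENNReal.coe_rpow_of_nonneg _ (by positivity)]
    push_cast
    rw [ENNReal.coe_rpow_of_nonneg _ (by positivity)]
    norm_num
  have hc₃ : (K : ℝ≥0∞) ^ (1 / q) = C₃ := (ENNReal.coe_rpow_of_nonneg _ (by positivity)).symm
  have hle₁ : C₁ ≤ 1 + C₁ + C₂ + C₃ + C₁ * C₃ := by
    have := zero_le (a := C₁ * C₃); have := zero_le (a := C₂); have := zero_le (a := C₃)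
    nlinarith
  have hle₂ : C₂ ≤ 1 + C₁ + C₂ + C₃ + C₁ * C₃ := by
    have := zero_le (a := C₁ * C₃); have := zero_le (a := C₁); have := zero_le (a := C₃)
    nlinarith
  have hle₃ : C₃ ≤ 1 + C₁ + C₂ + C₃ + C₁ * C₃ := by
    have := zero_le (a := C₁ * C₃); have := zero_le (a := C₁); have := zero_le (a := C₂)
    nlinarith
  have hle₄ : C₁ * C₃ ≤ 1 + C₁ + C₂ + C₃ + C₁ * C₃ := le_add_self
  -- The summand 1 gives positivity, and C₁ C₃ serves the lower bound on g: the product estimate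
  -- with the norm of h at most C₃.
  set C := 1 + C₁ + C₂ + C₃ + C₁ * C₃ with hC
  refine ⟨C, by positivity, fun ν hν => ⟨fun g hg h hh => ?_, fun f hf => ?_⟩⟩
  · have h1 : WeightedTent.normPQ p q ν ω (g * h : ℂ →ₘ[ν] ℂ) ≤
        C * WeightedTent.normPInf p ν ω g * WeightedTent.normInfQ q ν ω h := by
      rw [WeightedTent.normPQ_congr (AEEqFun.coeFn_mul g h)]
      refine (hC₁ ν hν g h g.stronglyMeasurable.measurable h.stronglyMeasurable.measurable hh).trans
        ?_
      gcongr
    exact ⟨h1.trans_lt (ENNReal.mul_lt_top (ENNReal.mul_lt_top ENNReal.coe_lt_top hg) hh), h1⟩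
  · obtain ⟨g, h, hg, hh, hfgh, hgn, hhn⟩ := WeightedTent.exists_factorization hp hq hK hν
      f.stronglyMeasurable.measurable hf
    rw [hc₂] at hgn
    rw [hc₃] at hhn
    have hga := AEEqFun.coeFn_mk g (hg.aestronglyMeasurable (μ := ν))
    have hha := AEEqFun.coeFn_mk h (hh.aestronglyMeasurable (μ := ν))
    have hg' : WeightedTent.normPInf p ν ω (AEEqFun.mk g (hg.aestronglyMeasurable (μ := ν))) =
      WeightedTent.normPInf p ν ω g := WeightedTent.normPInf_congr hga
    have hh' : WeightedTent.normInfQ q ν ω (AEEqFun.mk h (hh.aestronglyMeasurable (μ := ν))) =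
      WeightedTent.normInfQ q ν ω h := WeightedTent.normInfQ_congr hha
    have hhfin : WeightedTent.normInfQ q ν ω h < ∞ := hhn.trans_lt ENNReal.coe_lt_top
    refine ⟨AEEqFun.mk g hg.aestronglyMeasurable, ?_, AEEqFun.mk h hh.aestronglyMeasurable, ?_,
      ?_, ?_, ?_, ?_⟩
    · rw [WeightedTent.mem_tentPInf, hg']
      exact hgn.trans_lt (ENNReal.mul_lt_top ENNReal.coe_lt_top hf)
    · rw [WeightedTent.mem_tentInfQ, hh']
      exact hhfin
    · rw [AEEqFun.mk_mul_mk]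
      refine AEEqFun.ext ?_
      exact hfgh.trans (AEEqFun.coeFn_mk _ _).symm
    · rw [hg']
      exact hgn.trans (by gcongr)
    · rw [hg', WeightedTent.normPQ_congr hfgh]
      refine (hC₁ ν hν g h hg hh hhfin).trans ?_
      calc _ ≤ C₁ * WeightedTent.normPInf p ν ω g * C₃ := by gcongr
        _ = ((C₁ * C₃ : ℝ≥0) : ℝ≥0∞) * WeightedTent.normPInf p ν ω g := by push_cast; ring
        _ ≤ _ := by gcongr
    · rw [hh']
      exact hhn.trans (by gcongr)
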